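/- **Setting.** Let $X$ be an infinite set and let $b:X\times X\to[0,\infty)$ be a connected graph over $X$: $b$ is symmetric, $b(x,x)=0$, $\sum_{y}b(x,y)<\infty$ for all $x$, and any two points are joined by a finite path $x_0,\dots,x_n$ with $b(x_i,x_{i+1})>0$. Let $q:X\to\mathbb R$. Let $F(X)$ be the set of $f:X\to\mathbb R$ with $\sum_y b(x,y)|f(y)|<\infty$ for all $x$, and for $f\in F(X)$ put $Hf(x)=\sum_y b(x,y)(f(x)-f(y))+q(x)f(x)$. On the space $C_c(X)$ of finitely supported functions let $$h(\varphi,\psi)=\tfrac12\sum_{x,y}b(x,y)(\varphi(x)-\varphi(y))(\psi(x)-\psi(y))+\sum_x q(x)\varphi(x)\psi(x),\qquad h(\varphi)=h(\varphi,\varphi).$$ Assume $h\ge0$ on $C_c(X)$ and that $h$ is subcritical, i.e. there is $w:X\to[0,\infty)$, $w\ne0$, with $h(\varphi)\ge\sum_x w(x)\varphi(x)^2$ for all $\varphi\in C_c(X)$. Let $H^{(1)}$ be the self-adjoint operator in the real Hilbert space $\ell^2(X)$ (counting measure) associated with the closure of $h$, let $e^{-tH^{(1)}}$, $t\ge0$,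 be its heat semigroup (the strong limit of the semigroups of the Yosida approximations $nH^{(1)}(H^{(1)}+n)^{-1}$), and let $G(x,y)=\int_0^\infty e^{-tH^{(1)}}1_{x}(y)\,dt$ be the Green function. For $o\in X$ let $\|\varphi\|_{h,o}=(h(\varphi)+\varphi(o)^2)^{1/2}$ on $C_c(X)$, let $D_{h,o}$ be the completion of $C_c(X)$ in this norm, realized as a space of functions on $X$ (the pointwise limits of $\|\cdot\|_{h,o}$-Cauchy sequences in $C_c(X)$), and let $\bar h$ be the closure of $h$ on $D_{h,o}$: $\bar h(f)=\lim_n h(\varphi_n)$ for $\varphi_n\in C_c(X)$ with $\varphi_n\to f$ in $\|\cdot\|_{h,o}$, with $\bar h(f,g)$ obtained by polarization and $\|f\|_{h,o}=(\bar h(f)+f(o)^2)^{1/2}$. Put $\mathrm{cap}_h(x)=\inf\{h(\varphi)\mid\varphi\in C_c(X),\ \varphi(x)=1\}$. For finite $K\subseteq X$ let $H_K$ be the operator on $C_c(K)=\ell^2(K)$ associated with the restriction of $h$ to $C_c(K)$; functions on $K$ are extended by $0$ to $X$, and $H_K^{-1}1_x:=0$ if $x\notin K$. An exhaustion of $X$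 is a sequence of finite sets $K_n\subseteq K_{n+1}$ with $\bigcup_nK_n=X$. **Theorem (Properties of the Green function).** The resolvents $(H^{(1)}-\lambda)^{-1}$, $\lambda<0$, exist as bounded operators on $\ell^2(X)$, the strong limits defining $e^{-tH^{(1)}}$, $t\ge0$, exist, and the integral defining $G(x,y)$ converges absolutely for all $x,y\in X$. Moreover: (a) For all $x,y\in X$, $(H^{(1)}-\lambda)^{-1}1_x(y)$ is monotone increasing in $\lambda<0$ and converges to $G(x,y)$ as $\lambda\nearrow0$; $G(x,y)=G(y,x)$; and $G(x,\cdot),G(\cdot,x)\in F(X)$ with $HG(x,\cdot)=HG(\cdot,x)=1_x$ on $X$. (b) Every $H_K$, $K\subseteq X$ finite, is invertible. For every exhaustion $(K_n)$ and every $x\in X$, $H_{K_n}^{-1}1_x(y)$ is monotone increasing in $n$ and converges to $G(x,y)$ for every $y\in X$, and $\|G(x,\cdot)-H_{K_n}^{-1}1_x\|_{h,o}\to0$ for every $o\in X$. For all $o,x\in X$ we have $G(x,\cdot)\in D_{h,o}$, and for $g\in D_{h,o}$ the following are equivalent: (i) $g=G(x,\cdot)$; (ii) $g(x)\neq0$ and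 $\bar h(g/g(x))=\mathrm{cap}_h(x)=1/g(x)$; (iii) $g\in F(X)$ and $Hg=1_x$; (iv) $\bar h(g,f)=f(x)$ for all $f\in D_{h,o}$. Moreover, for $g\in D_{h,o}$, one has $g(x)\ne0$ and $\bar h(g/g(x))=\mathrm{cap}_h(x)$ if and only if $g=c\,G(x,\cdot)$ for some real $c\ne0$. (c) For every $x\in X$, $G(x,\cdot)$ is the smallest (pointwise) among all $g\in F(X)$ with $g\ge0$, $g\ne0$ and $Hg\ge1_x$ on $X$. -/

import Mathlib

open Filter Topology MeasureTheory

noncomputable section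

namespace SchrodingerGraph

/-- A graph over `X`: a symmetric, locally summable weight `b : X × X → [0,∞)` with zero
diagonal. -/
structure WGraph (X : Type*) where
  b : X → X → ℝ
  nonneg : ∀ x y, 0 ≤ b x y
  symm : ∀ x y, b x y = b y x
  diag : ∀ x, b x x = 0
  summable : ∀ x, Summable (fun y => b x y)

/-- The real Hilbert space `ℓ²(X)` with respect to the counting measure. -/
abbrev EllTwo (X : Type*) := lp (fun _ : X => ℝ) 2

/-- The inclusion of `C_c(X)` (finitely supported functions) into `ℓ²(X)`. -/
def toL2 {X : Type*} (φ : X →₀ ℝ) : EllTwo X :=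
  ⟨fun x => φ x, (memℓp_zero φ.hasFiniteSupport).of_exponent_ge zero_le⟩

/-- The function `1_x`. -/
def ind {X : Type*} (x : X) : X → ℝ := Set.indicator {x} 1

namespace WGraph

variable {X : Type*} (B : WGraph X) (q : X → ℝ)

/-- Any two vertices are joined by a finite path of edges. -/
def Connected : Prop := ∀ x y, Relation.ReflTransGen (fun u v => 0 < B.b u v) x y

/-- The space `F(X)`. -/
def F : Set (X → ℝ) := {f | ∀ x, Summable (fun y => B.b x y * |f y|)}

/-- The formal Schrödinger operator `H = L + q` (meaningful on `F(X)`). -/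
def H (f : X → ℝ) (x : X) : ℝ := ∑' y, B.b x y * (f x - f y) + q x * f x

/-- The bilinear form `h` on `C_c(X)`. -/
def h (φ ψ : X →₀ ℝ) : ℝ :=
  (1 / 2) * ∑' p : X × X, B.b p.1 p.2 * (φ p.1 - φ p.2) * (ψ p.1 - ψ p.2)
    + ∑ x ∈ φ.support, q x * φ x * ψ x

/-- `h ≥ 0` on `C_c(X)`. -/
def FormNonneg : Prop := ∀ φ : X →₀ ℝ, 0 ≤ B.h q φ φ

/-- `h` is subcritical: `h - w ≥ 0` on `C_c(X)` for some `w ≥ 0`, `w ≠ 0`. -/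
def Subcritical : Prop :=
  ∃ w : X → ℝ, (∀ x, 0 ≤ w x) ∧ w ≠ 0 ∧
    ∀ φ : X →₀ ℝ, 0 ≤ B.h q φ φ - ∑ x ∈ φ.support, w x * φ x ^ 2

/-! ### The self-adjoint operator on `ℓ²(X)`, its resolvent and its semigroup -/

/-- `φ` is Cauchy for the form norm `(h(·) + ‖·‖²)^{1/2}` and converges to `f` in `ℓ²(X)`. -/
def ApproxL2 (φ : ℕ → X →₀ ℝ) (f : EllTwo X) : Prop :=
  (∀ ε > 0, ∃ N, ∀ m ≥ N, ∀ n ≥ N, B.h q (φ m - φ n) (φ m - φ n) < ε) ∧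
    Tendsto (fun n => toL2 (φ n)) atTop (𝓝 f)

/-- The domain of the closure `h⁽¹⁾` of `h` in `ℓ²(X)`. -/
def domL2 : Set (EllTwo X) := {f | ∃ φ, B.ApproxL2 q φ f}

open Classical in
/-- The quadratic form `h⁽¹⁾` (the limit does not depend on the approximating sequence). -/
def quadL2 (f : EllTwo X) : ℝ :=
  if hf : ∃ φ, B.ApproxL2 q φ f then
    limUnder atTop (fun n => B.h q (hf.choose n) (hf.choose n)) else 0

/-- The bilinear form `h⁽¹⁾`, by polarization. -/
def formL2 (f g : EllTwo X) : ℝ := (B.quadL2 q (f + g) - B.quadL2 q (f - g)) / 4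

/-- `f ∈ D(H⁽¹⁾)` and `H⁽¹⁾ f = g`, for the operator `H⁽¹⁾` associated with `h⁽¹⁾`. -/
def OpL2 (f g : EllTwo X) : Prop :=
  f ∈ B.domL2 q ∧ ∀ u ∈ B.domL2 q, B.formL2 q f u = inner ℝ g u

/-- `R` is the bounded everywhere defined inverse of `H⁽¹⁾ - l`. -/
def IsResolvent (l : ℝ) (R : EllTwo X →L[ℝ] EllTwo X) : Prop :=
  ∀ f u, R f = u ↔ B.OpL2 q u (f + l • u)

open Classical in
/-- The resolvent `(H⁽¹⁾ - l)⁻¹`; the value `0` is used if `l` is not in the resolvent set. -/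
def res (l : ℝ) : EllTwo X →L[ℝ] EllTwo X :=
  if hl : ∃ R, B.IsResolvent q l R then hl.choose else 0

/-- The bounded Yosida approximation `n H⁽¹⁾ (H⁽¹⁾ + n)⁻¹ = n - n² (H⁽¹⁾ + n)⁻¹` of `H⁽¹⁾`. -/
def yosida (n : ℕ) : EllTwo X →L[ℝ] EllTwo X :=
  (n : ℝ) • ContinuousLinearMap.id ℝ (EllTwo X) - (n : ℝ) ^ 2 • B.res q (-(n : ℝ))

/-- The heat semigroup `e^{-tH⁽¹⁾} f`, as the limit of `e^{-t H_n} f` where `H_n` are the Yosida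
approximations of `H⁽¹⁾` (Hille-Yosida). -/
def heat (t : ℝ) (f : EllTwo X) : EllTwo X :=
  limUnder atTop (fun n : ℕ => NormedSpace.exp ((-t) • B.yosida q n) f)

/-- The positive minimal Green function `G(x,y) = ∫₀^∞ e^{-tH⁽¹⁾} 1_x (y) dt`. -/
def green (x y : X) : ℝ :=
  ∫ t in Set.Ioi (0 : ℝ), B.heat q t (toL2 (Finsupp.single x 1)) y

/-! ### The extended space -/

/-- The norm `‖·‖_{h,o}` on `C_c(X)`. -/
def preNorm (o : X) (φ : X →₀ ℝ) : ℝ := √(B.h q φ φ + φ o ^ 2)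

/-- `φ` is a `‖·‖_{h,o}`-Cauchy sequence in `C_c(X)` with pointwise limit `f`. -/
def ApproxExt (o : X) (φ : ℕ → X →₀ ℝ) (f : X → ℝ) : Prop :=
  (∀ ε > 0, ∃ N, ∀ m ≥ N, ∀ n ≥ N, B.preNorm q o (φ m - φ n) < ε) ∧
    ∀ x, Tendsto (fun n => φ n x) atTop (𝓝 (f x))

/-- The extended space `D_{h,o}`: the `‖·‖_{h,o}`-completion of `C_c(X)`, realized as a space of
functions (`‖·‖_{h,o}`-Cauchy sequences converge pointwise). -/
def Dext (o : X) : Set (X → ℝ) := {f | ∃ φ, B.ApproxExt q o φ f}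

open Classical in
/-- The quadratic form of the closure of `h` on `D_{h,o}` (the limit does not depend on the
approximating sequence). -/
def quadExt (o : X) (f : X → ℝ) : ℝ :=
  if hf : ∃ φ, B.ApproxExt q o φ f then
    limUnder atTop (fun n => B.h q (hf.choose n) (hf.choose n)) else 0

/-- The bilinear form of the closure of `h` on `D_{h,o}`, by polarization. -/
def formExt (o : X) (f g : X → ℝ) : ℝ := (B.quadExt q o (f + g) - B.quadExt q o (f - g)) / 4

/-- The norm `‖·‖_{h,o}` on `D_{h,o}`. -/
def normExt (o : X) (f : X → ℝ) : ℝ := √(B.quadExt q o f + f o ^ 2)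

/-- The capacity `inf {h(f) | f ∈ C_c(X), f(x) = 1}` of the point `x`. -/
def cap (x : X) : ℝ := sInf {r | ∃ φ : X →₀ ℝ, φ x = 1 ∧ r = B.h q φ φ}

/-! ### Restriction to finite sets -/

/-- The operator `H_K` on `C_c(K) = ℓ²(K)` associated with the restriction of `h` to `C_c(K)`,
as a matrix in the orthonormal basis `(1_x)`, `x ∈ K`. -/
def HK (K : Finset X) : Matrix K K ℝ :=
  Matrix.of fun x y => B.h q (Finsupp.single x.1 1) (Finsupp.single y.1 1)

open Classical in
/-- `H_K⁻¹` applied to the restriction of `f` to `K`, extended by zero to `X`. -/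
def invHK (K : Finset X) (f : X → ℝ) : X →₀ ℝ :=
  ∑ z : K, Finsupp.single z.1 (((B.HK q K)⁻¹.mulVec fun y : K => f y.1) z)

end WGraph

/-- An exhaustion of `X` by an increasing sequence of finite sets. -/
def IsExhaustion {X : Type*} (K : ℕ → Finset X) : Prop :=
  (∀ n, K n ⊆ K (n + 1)) ∧ ∀ x, ∃ n, x ∈ K n

end SchrodingerGraph

end

/-! Subcriticality at one point, carried along edges by connectedness, bounds every point evaluation
by the energy norm √h (`pointBounded_of_subcritical`). Hence C_c(X) completes to a Hilbert space E
of functions on X, in which evaluation at x is represented by a kernel k_x. The formal operator acts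
weakly on E, Hξ(x) = ⟨1_x, ξ⟩ (`H_val`), so k_x is the unique solution in E of Hk_x = 1_x. The norms
‖·‖_{h,o} are equivalent to √h, so every D_{h,o} is E. The solution on a finite K is the orthogonal
projection of k_x onto C_c(K), which gives convergence along exhaustions; a minimum principle on
finite sets gives positivity, monotonicity and minimality of k_x; the capacity statements are
Cauchy–Schwarz and its equality case.

It remains to see that k_x = G(x,·). For α > 0 the same construction with potential q + α yields the
form domain of the closure in ℓ²(X), with embedding ι into ℓ²(X), and the resolvent at -α is ιι*
(`res_eq`); its entries are the kernels of q + α. By minimality they increase as α decreases and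
stay below k_x, and their limit solves Hg = 1_x with 0 ≤ g ≤ k_x, so it is k_x. The heat semigroup
is built by Hille–Yosida, its Laplace transform is the resolvent (`integral_exp_mul_eq`), and
positivity allows α → 0 under the integral (`integral_eq_of_tendsto_laplace`). -/

set_option linter.unusedSectionVars false

/-! ### Formal operator, Green's formula and bounds on point evaluations. -/

namespace SchrodingerGraph

/-- A kernel that is summable in the second variable, tested in the first variable against a
finitely supported function. -/
lemma hasSum_prod_finsupp {X : Type*} (φ : X →₀ ℝ) {v : X → X → ℝ} (hv : ∀ x, Summable (v x)) :
    HasSum (fun p : X × X => φ p.1 * v p.1 p.2) (φ.sum fun x a => a * ∑' y, v x y) := by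
  induction φ using Finsupp.induction_linear with
  | zero => simp
  | add f g hf hg =>
    rw [Finsupp.sum_add_index' (by simp) (by intros; ring)]
    simpa [add_mul] using hf.add hg
  | single x a =>
    rw [Finsupp.sum_single_index (by simp)]
    have hinj : Function.Injective (Prod.mk x : X → X × X) := Prod.mk_right_injective x
    rw [← hinj.hasSum_iff]
    · simpa [Function.comp_def] using (hv x).hasSum.mul_left a
    · rintro ⟨x', y⟩ hx
      have : x ≠ x' := by rintro rfl; exact hx ⟨y, rfl⟩
      simp [this]

namespace WGraph

variable {X : Type*} (B : WGraph X) (q : X → ℝ)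

/-- The weighted degree `∑_y b(x,y)`. -/
noncomputable def deg (x : X) : ℝ := ∑' y, B.b x y

variable {B q}

lemma mem_F_iff {f : X → ℝ} : f ∈ B.F ↔ ∀ x, Summable (fun y => B.b x y * f y) := by
  refine forall_congr' fun x => ?_
  rw [← summable_abs_iff (f := fun y => B.b x y * f y)]
  simp [abs_mul, abs_of_nonneg (B.nonneg _ _)]

lemma finsupp_mem_F (φ : X →₀ ℝ) : ⇑φ ∈ B.F := by
  refine mem_F_iff.2 fun x => summable_of_ne_finset_zero (s := φ.support) fun y hy => ?_
  simp [Finsupp.notMem_support_iff.1 hy]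

lemma add_mem_F {f g : X → ℝ} (hf : f ∈ B.F) (hg : g ∈ B.F) : f + g ∈ B.F :=
  mem_F_iff.2 fun x => by
    simpa [mul_add] using (mem_F_iff.1 hf x).add (mem_F_iff.1 hg x)

lemma smul_mem_F {f : X → ℝ} (hf : f ∈ B.F) (c : ℝ) : c • f ∈ B.F :=
  mem_F_iff.2 fun x => by
    simpa [mul_left_comm] using (mem_F_iff.1 hf x).mul_left c

lemma sub_mem_F {f g : X → ℝ} (hf : f ∈ B.F) (hg : g ∈ B.F) : f - g ∈ B.F :=
  mem_F_iff.2 fun x => by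
    simpa [mul_sub] using (mem_F_iff.1 hf x).sub (mem_F_iff.1 hg x)

lemma mem_F_of_abs_le {f g : X → ℝ} (hg : g ∈ B.F) (h : ∀ x, |f x| ≤ g x) : f ∈ B.F :=
  fun x => Summable.of_nonneg_of_le (fun _ => mul_nonneg (B.nonneg _ _) (abs_nonneg _))
    (fun y => mul_le_mul_of_nonneg_left (h y) (B.nonneg _ _)) (mem_F_iff.1 hg x)

lemma summable_diff {f : X → ℝ} (hf : f ∈ B.F) (x : X) :
    Summable fun y => B.b x y * (f x - f y) := by
  simpa [mul_sub] using ((B.summable x).mul_right (f x)).sub (mem_F_iff.1 hf x)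

lemma H_eq {f : X → ℝ} (hf : f ∈ B.F) (x : X) :
    B.H q f x = (B.deg x + q x) * f x - ∑' y, B.b x y * f y := by
  have : ∑' y, B.b x y * (f x - f y) = B.deg x * f x - ∑' y, B.b x y * f y := by
    simp_rw [mul_sub]
    rw [((B.summable x).mul_right (f x)).tsum_sub (mem_F_iff.1 hf x), tsum_mul_right, deg]
  rw [H, this]; ring

lemma H_add {f g : X → ℝ} (hf : f ∈ B.F) (hg : g ∈ B.F) : B.H q (f + g) = B.H q f + B.H q g := by
  ext x
  rw [Pi.add_apply, H_eq hf, H_eq hg, H_eq (add_mem_F hf hg)]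
  simp_rw [Pi.add_apply, mul_add]
  rw [(mem_F_iff.1 hf x).tsum_add (mem_F_iff.1 hg x)]
  ring

lemma H_smul {f : X → ℝ} (c : ℝ) : B.H q (c • f) = c • B.H q f := by
  ext x
  have : ∀ y, B.b x y * (c * f x - c * f y) = c * (B.b x y * (f x - f y)) := fun y => by ring
  simp only [H, Pi.smul_apply, smul_eq_mul, this, tsum_mul_left]
  ring

lemma H_sub {f g : X → ℝ} (hf : f ∈ B.F) (hg : g ∈ B.F) : B.H q (f - g) = B.H q f - B.H q g := by
  have := H_add (q := q) hf (smul_mem_F hg (-1))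
  rw [H_smul] at this
  simpa [sub_eq_add_neg] using this

lemma H_add_potential (α : ℝ) (f : X → ℝ) (x : X) :
    B.H (fun y => q y + α) f x = B.H q f x + α * f x := by
  simp only [H]; ring

/-- The double sum defining the energy converges. -/
lemma hasSum_energy (φ ψ : X →₀ ℝ) :
    HasSum (fun p : X × X => B.b p.1 p.2 * (φ p.1 - φ p.2) * (ψ p.1 - ψ p.2))
      (2 * φ.sum fun x a => a * ∑' y, B.b x y * (ψ x - ψ y)) := by
  have h1 := hasSum_prod_finsupp φ (summable_diff (B := B) (finsupp_mem_F ψ))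
  have h2 := (Equiv.prodComm X X).hasSum_iff.2 h1
  -- The product splits as φ(x)·b(x,y)(ψ(x)-ψ(y)) plus the same expression with x and y exchanged,
  -- which has the same sum by symmetry of b; hence the factor 2.
  rw [two_mul]
  refine (h1.add h2).congr_fun ?_
  rintro ⟨x, y⟩
  simp [B.symm y x]
  ring

/-- Green's formula on `C_c(X)`. -/
lemma h_eq_sum (φ ψ : X →₀ ℝ) : B.h q φ ψ = φ.sum fun x a => a * B.H q ψ x := by
  rw [h, (hasSum_energy φ ψ).tsum_eq]
  simp only [Finsupp.sum, H, Finset.mul_sum, mul_add]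
  rw [← Finset.sum_add_distrib]
  exact Finset.sum_congr rfl fun x _ => by ring

lemma h_comm (φ ψ : X →₀ ℝ) : B.h q φ ψ = B.h q ψ φ := by
  classical
  have key : ∀ φ ψ : X →₀ ℝ, ∑ x ∈ φ.support, q x * φ x * ψ x =
      ∑ x ∈ φ.support ∪ ψ.support, q x * φ x * ψ x := fun φ ψ =>
    Finset.sum_subset Finset.subset_union_left fun x _ hx => by
      simp [Finsupp.notMem_support_iff.1 hx]
  rw [h, h, key, key ψ φ, Finset.union_comm]
  simp only [mul_right_comm]

lemma h_add_left (φ φ' ψ : X →₀ ℝ) : B.h q (φ + φ') ψ = B.h q φ ψ + B.h q φ' ψ := by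
  simp only [h_eq_sum]
  exact Finsupp.sum_add_index' (by simp) (by intros; ring)

lemma h_smul_left (c : ℝ) (φ ψ : X →₀ ℝ) : B.h q (c • φ) ψ = c * B.h q φ ψ := by
  simp only [h_eq_sum]
  rw [Finsupp.sum_smul_index (by simp), Finsupp.mul_sum]
  simp only [mul_assoc]

lemma h_single_left (x : X) (a : ℝ) (ψ : X →₀ ℝ) :
    B.h q (Finsupp.single x a) ψ = a * B.H q ψ x := by
  rw [h_eq_sum, Finsupp.sum_single_index (by simp)]

lemma h_add_potential (α : ℝ) (φ ψ : X →₀ ℝ) :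
    B.h (fun y => q y + α) φ ψ = B.h q φ ψ + α * ∑ x ∈ φ.support, φ x * ψ x := by
  simp only [h, add_mul, Finset.sum_add_distrib, Finset.mul_sum]
  ring_nf

/-- The pre-Hilbert structure on `C_c(X)` given by a nonnegative form. -/
noncomputable abbrev preCore (hq : B.FormNonneg q) : PreInnerProductSpace.Core ℝ (X →₀ ℝ) where
  inner φ ψ := B.h q φ ψ
  conj_inner_symm φ ψ := h_comm ψ φ
  re_inner_nonneg φ := hq φ
  add_left := h_add_left
  smul_left φ ψ c := h_smul_left c φ ψ

lemma abs_h_le (hq : B.FormNonneg q) (φ ψ : X →₀ ℝ) :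
    |B.h q φ ψ| ≤ √(B.h q φ φ) * √(B.h q ψ ψ) := by
  have := @InnerProductSpace.Core.norm_inner_le_norm ℝ (X →₀ ℝ) _ _ _ (preCore hq) φ ψ
  exact this

/-- The absolute value of a finitely supported function. -/
noncomputable def fabs (φ : X →₀ ℝ) : X →₀ ℝ := φ.mapRange abs abs_zero

@[simp] lemma fabs_apply (φ : X →₀ ℝ) (x : X) : fabs φ x = |φ x| := rfl

/-- The potential term only sees φ², and ||a|-|b|| ≤ |a-b| edge by edge. -/
lemma h_fabs_le (φ : X →₀ ℝ) : B.h q (fabs φ) (fabs φ) ≤ B.h q φ φ := by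
  have hs : ∑ x ∈ (fabs φ).support, q x * fabs φ x * fabs φ x =
      ∑ x ∈ φ.support, q x * φ x * φ x := by
    have : (fabs φ).support = φ.support := by ext; simp
    rw [this]
    exact Finset.sum_congr rfl fun x _ => by rw [fabs_apply, mul_assoc, abs_mul_abs_self, mul_assoc]
  rw [h, h, hs]
  have := (hasSum_energy (B := B) (fabs φ) (fabs φ)).summable.tsum_le_tsum (fun p => ?_)
    (hasSum_energy (B := B) φ φ).summable
  · linarith
  · rw [mul_assoc, mul_assoc]
    refine mul_le_mul_of_nonneg_left ?_ (B.nonneg _ _)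
    rw [← abs_mul_abs_self (φ p.1 - φ p.2), ← abs_mul_abs_self (fabs φ p.1 - fabs φ p.2)]
    exact mul_self_le_mul_self (abs_nonneg _) (abs_abs_sub_abs_le_abs_sub _ _)

/-- The sum is what remains of H|φ|(x) = h(1_x, |φ|) after the diagonal term is split off;
Cauchy–Schwarz for h bounds that value, and |φ| has no more energy than φ. This is a local
Harnack-type estimate: control of φ at x gives control at all neighbours. -/
lemma tsum_abs_le (hq : B.FormNonneg q) (φ : X →₀ ℝ) (x : X) :
    ∑' y, B.b x y * |φ y| ≤ |B.deg x + q x| * |φ x| +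
      √(B.h q (Finsupp.single x 1) (Finsupp.single x 1)) * √(B.h q φ φ) := by
  have h1 := H_eq (q := q) (finsupp_mem_F (B := B) (fabs φ)) x
  have h2 := abs_h_le hq (Finsupp.single x 1) (fabs φ)
  rw [h_single_left x 1 (fabs φ), one_mul] at h2
  have h3 := mul_le_mul_of_nonneg_left (Real.sqrt_le_sqrt (h_fabs_le (B := B) (q := q) φ))
    (Real.sqrt_nonneg (B.h q (Finsupp.single x 1) (Finsupp.single x 1)))
  have h4 := neg_abs_le (B.H q (fabs φ) x)
  have h5 := mul_le_mul_of_nonneg_right (le_abs_self (B.deg x + q x)) (abs_nonneg (φ x))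
  simp only [fabs_apply] at h1
  linarith

variable (B q) in
/-- The form is nonnegative and controls point evaluations. -/
def PointBounded : Prop :=
  B.FormNonneg q ∧ ∀ x, ∃ C, ∀ φ : X →₀ ℝ, |φ x| ≤ C * √(B.h q φ φ)

lemma PointBounded.exists_sum_le (hq : B.PointBounded q) (x : X) :
    ∃ C, 0 ≤ C ∧ ∀ φ : X →₀ ℝ, ∑' y, B.b x y * |φ y| ≤ C * √(B.h q φ φ) := by
  obtain ⟨C, hC⟩ := hq.2 x
  refine ⟨|B.deg x + q x| * |C| + √(B.h q (Finsupp.single x 1) (Finsupp.single x 1)),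
    by positivity, fun φ => (tsum_abs_le hq.1 φ x).trans ?_⟩
  have := mul_le_mul_of_nonneg_left ((hC φ).trans
    (mul_le_mul_of_nonneg_right (le_abs_self C) (Real.sqrt_nonneg _))) (abs_nonneg (B.deg x + q x))
  linarith

/-- At a point z with w(z) > 0 the bound is subcriticality itself. It passes from u to a neighbour v
because b(u,v)|φ(v)| is one term of the sum in `tsum_abs_le`. -/
lemma pointBounded_of_subcritical (hconn : B.Connected) (hq : B.FormNonneg q)
    (hsub : B.Subcritical q) : B.PointBounded q := by
  refine ⟨hq, fun x => ?_⟩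
  obtain ⟨w, hw0, hw, hwh⟩ := hsub
  obtain ⟨z, hz⟩ := Function.ne_iff.1 hw
  have hz : 0 < w z := lt_of_le_of_ne (hw0 z) (Ne.symm hz)
  induction hconn z x with
  | refl =>
    refine ⟨(√(w z))⁻¹, fun φ => ?_⟩
    have h1 : w z * φ z ^ 2 ≤ ∑ x ∈ φ.support, w x * φ x ^ 2 := by
      by_cases h : z ∈ φ.support
      · exact Finset.single_le_sum (f := fun x => w x * φ x ^ 2)
          (fun y _ => mul_nonneg (hw0 y) (sq_nonneg _)) h
      · rw [Finsupp.notMem_support_iff.1 h]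
        simpa using Finset.sum_nonneg fun y _ => mul_nonneg (hw0 y) (sq_nonneg (φ y))
    have h2 : w z * φ z ^ 2 ≤ B.h q φ φ := by linarith [hwh φ]
    have h3 := Real.sqrt_le_sqrt h2
    rw [Real.sqrt_mul hz.le, Real.sqrt_sq_eq_abs] at h3
    rwa [inv_mul_eq_div, le_div_iff₀' (Real.sqrt_pos.2 hz)]
  | tail _ hyz ih =>
    rename_i u v _
    obtain ⟨C, hC⟩ := ih
    have hb : 0 < B.b u v := hyz
    refine ⟨(B.b u v)⁻¹ * (|B.deg u + q u| * C +
      √(B.h q (Finsupp.single u 1) (Finsupp.single u 1))), fun φ => ?_⟩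
    have h1 : B.b u v * |φ v| ≤ ∑' y, B.b u y * |φ y| :=
      (finsupp_mem_F (B := B) φ u).le_tsum v fun y _ => mul_nonneg (B.nonneg _ _) (abs_nonneg _)
    have h2 := tsum_abs_le hq φ u
    have h3 := mul_le_mul_of_nonneg_left (hC φ) (abs_nonneg (B.deg u + q u))
    rw [mul_assoc, inv_mul_eq_div, le_div_iff₀' hb]
    linarith

lemma PointBounded.eq_zero (hq : B.PointBounded q) {φ : X →₀ ℝ} (h : B.h q φ φ ≤ 0) : φ = 0 := by
  ext x
  obtain ⟨C, hC⟩ := hq.2 x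
  have := hC φ
  rw [Real.sqrt_eq_zero_of_nonpos h, mul_zero] at this
  simpa using this

/-- Lets all results for q be applied to q + α, whose Green kernel will be the resolvent at -α. -/
lemma PointBounded.add_const (hq : B.PointBounded q) {α : ℝ} (hα : 0 ≤ α) :
    B.PointBounded fun x => q x + α := by
  have hle : ∀ φ : X →₀ ℝ, B.h q φ φ ≤ B.h (fun x => q x + α) φ φ := fun φ => by
    rw [h_add_potential]
    have := mul_nonneg hα (Finset.sum_nonneg fun x (_ : x ∈ φ.support) => mul_self_nonneg (φ x))
    linarith
  refine ⟨fun φ => (hq.1 φ).trans (hle φ), fun x => ?_⟩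
  obtain ⟨C, hC⟩ := hq.2 x
  refine ⟨|C|, fun φ => (hC φ).trans ?_⟩
  exact mul_le_mul (le_abs_self C) (Real.sqrt_le_sqrt (hle φ)) (Real.sqrt_nonneg _) (abs_nonneg _)

/-- The Hilbert space completion of a pointwise bounded form. -/
lemma PointBounded.exists_completion.{u} {X : Type u} {B : WGraph X} {q : X → ℝ}
    (hq : B.PointBounded q) :
    ∃ (E : Type u) (_ : NormedAddCommGroup E) (_ : InnerProductSpace ℝ E) (_ : CompleteSpace E)
      (J : (X →₀ ℝ) →ₗ[ℝ] E), DenseRange J ∧ ∀ φ ψ, inner ℝ (J φ) (J ψ) = B.h q φ ψ := by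
  let c : InnerProductSpace.Core ℝ (X →₀ ℝ) :=
    { preCore hq.1 with definite := fun φ h => hq.eq_zero (le_of_eq h) }
  let _ : NormedAddCommGroup (X →₀ ℝ) := c.toNormedAddCommGroup
  let _ : InnerProductSpace ℝ (X →₀ ℝ) := InnerProductSpace.ofCore c.toCore
  refine ⟨UniformSpace.Completion (X →₀ ℝ), inferInstance, inferInstance, inferInstance,
    (UniformSpace.Completion.toComplL (𝕜 := ℝ)).toLinearMap,
    UniformSpace.Completion.denseRange_coe, fun φ ψ => ?_⟩
  exact UniformSpace.Completion.inner_coe φ ψ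

end WGraph
end SchrodingerGraph

/-! ### The completion as a reproducing kernel space and as the extended space. -/

namespace SchrodingerGraph

namespace WGraph

variable {X : Type*} {B : WGraph X} {q : X → ℝ}
variable {E : Type*} [NormedAddCommGroup E] [InnerProductSpace ℝ E] [CompleteSpace E]
  {J : (X →₀ ℝ) →ₗ[ℝ] E}

/-- The representer of the evaluation at `x`. -/
noncomputable def kernel (J : (X →₀ ℝ) →ₗ[ℝ] E) (x : X) : E :=
  (InnerProductSpace.toDual ℝ E).symm ((Finsupp.lapply x : (X →₀ ℝ) →ₗ[ℝ] ℝ).extendOfNorm J)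

/-- The function on `X` represented by an element of the completion. -/
noncomputable def val (J : (X →₀ ℝ) →ₗ[ℝ] E) : E →ₗ[ℝ] X → ℝ where
  toFun ξ x := inner ℝ (kernel J x) ξ
  map_add' ξ η := by ext; simp [inner_add_right]
  map_smul' c ξ := by ext; simp [inner_smul_right]

lemma val_apply (ξ : E) (x : X) : val J ξ x = inner ℝ (kernel J x) ξ := rfl

lemma val_kernel_comm (x y : X) : val J (kernel J x) y = val J (kernel J y) x :=
  real_inner_comm _ _

lemma continuous_val (x : X) : Continuous fun ξ => val J ξ x := by
  simp only [val_apply]; fun_prop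

lemma abs_val_le (ξ : E) (x : X) : |val J ξ x| ≤ ‖kernel J x‖ * ‖ξ‖ := abs_real_inner_le_norm _ _

variable (B q J) in
/-- `J : C_c(X) → E` is a Hilbert space completion of the pointwise bounded form `h`. -/
structure IsCompletion : Prop where
  pointBounded : B.PointBounded q
  dense : DenseRange J
  inner_eq : ∀ φ ψ, inner ℝ (J φ) (J ψ) = B.h q φ ψ

namespace IsCompletion

variable (hJ : B.IsCompletion q J)
include hJ

lemma norm_sq_eq (φ : X →₀ ℝ) : ‖J φ‖ ^ 2 = B.h q φ φ := by
  rw [← hJ.inner_eq, real_inner_self_eq_norm_sq]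

lemma norm_eq (φ : X →₀ ℝ) : ‖J φ‖ = √(B.h q φ φ) := by
  rw [← hJ.norm_sq_eq, Real.sqrt_sq (norm_nonneg _)]

/-- `extendOfNorm` is a true extension only for a bounded functional on a dense range; pointwise
boundedness and density of `J` supply this. -/
lemma val_J (φ : X →₀ ℝ) : val J (J φ) = φ := by
  ext x
  obtain ⟨C, hC⟩ := hJ.pointBounded.2 x
  have h : ∃ C, ∀ φ, ‖(Finsupp.lapply x : (X →₀ ℝ) →ₗ[ℝ] ℝ) φ‖ ≤ C * ‖J φ‖ :=
    ⟨C, fun φ => by rw [hJ.norm_eq]; exact hC φ⟩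
  simp [val_apply, kernel, LinearMap.extendOfNorm_eq hJ.dense h]

lemma inner_kernel_J (x : X) (φ : X →₀ ℝ) : inner ℝ (kernel J x) (J φ) = φ x :=
  congrFun (hJ.val_J φ) x

/-- Each finite partial sum is continuous in ξ, so its bound extends from C_c(X) to E by density;
the uniform bound then gives summability. -/
lemma exists_sum_val_le (x : X) :
    ∃ C, 0 ≤ C ∧ ∀ ξ, Summable (fun y => B.b x y * |val J ξ y|) ∧
      ∑' y, B.b x y * |val J ξ y| ≤ C * ‖ξ‖ := by
  obtain ⟨C, hC0, hC⟩ := hJ.pointBounded.exists_sum_le x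
  have key : ∀ ξ, ∀ s : Finset X, ∑ y ∈ s, B.b x y * |val J ξ y| ≤ C * ‖ξ‖ := by
    intro ξ s
    refine hJ.dense.induction_on ξ (isClosed_le ?_ (by fun_prop)) fun φ => ?_
    · exact continuous_finsetSum _ fun y _ => ((continuous_val y).abs.const_mul _)
    · rw [hJ.val_J, hJ.norm_eq]
      exact ((finsupp_mem_F (B := B) φ x).sum_le_tsum s
        fun y _ => mul_nonneg (B.nonneg _ _) (abs_nonneg _)).trans (hC φ)
  refine ⟨C, hC0, fun ξ => ?_⟩
  have hnn : ∀ y, 0 ≤ B.b x y * |val J ξ y| := fun y => mul_nonneg (B.nonneg _ _) (abs_nonneg _)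
  have hs := summable_of_sum_le hnn (key ξ)
  exact ⟨hs, hs.tsum_le_of_sum_le (key ξ)⟩

lemma val_mem_F (ξ : E) : val J ξ ∈ B.F := fun x =>
  let ⟨_, _, h⟩ := hJ.exists_sum_val_le x
  (h ξ).1

/-- The formal operator acts weakly on the completion. -/
lemma H_val (ξ : E) (x : X) : B.H q (val J ξ) x = inner ℝ (J (Finsupp.single x 1)) ξ := by
  obtain ⟨C, hC0, hC⟩ := hJ.exists_sum_val_le x
  let T : E →ₗ[ℝ] ℝ :=
    { toFun := fun ξ => B.H q (val J ξ) x
      map_add' := fun ξ η => by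
        rw [map_add, H_add (hJ.val_mem_F ξ) (hJ.val_mem_F η), Pi.add_apply]
      map_smul' := fun c ξ => by rw [map_smul, H_smul]; rfl }
  let T' : E →L[ℝ] ℝ := T.mkContinuous (|B.deg x + q x| * ‖kernel J x‖ + C) fun ξ => by
    change ‖B.H q (val J ξ) x‖ ≤ _
    rw [H_eq (hJ.val_mem_F ξ), add_mul (_ * _) C]
    refine (norm_sub_le _ _).trans (add_le_add ?_ ?_)
    · rw [Real.norm_eq_abs, abs_mul, mul_assoc]
      exact mul_le_mul_of_nonneg_left (abs_val_le ξ x) (abs_nonneg _)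
    · refine le_trans (norm_tsum_le_tsum_norm ?_) ?_
      · simpa [abs_mul, abs_of_nonneg (B.nonneg _ _)] using (hC ξ).1
      · simpa [abs_mul, abs_of_nonneg (B.nonneg _ _)] using (hC ξ).2
  -- Both sides are continuous functionals of ξ and agree on the dense image of C_c(X).
  have : (fun ξ => T' ξ) = fun ξ => inner ℝ (J (Finsupp.single x 1)) ξ := by
    refine hJ.dense.equalizer T'.continuous (by fun_prop) (funext fun φ => ?_)
    change B.H q (val J (J φ)) x = inner ℝ (J (Finsupp.single x 1)) (J φ)
    rw [hJ.val_J, hJ.inner_eq, h_single_left, one_mul]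
  exact congrFun this ξ

lemma inner_J_left (φ : X →₀ ℝ) (ξ : E) :
    inner ℝ (J φ) ξ = φ.sum fun x a => a * B.H q (val J ξ) x := by
  induction φ using Finsupp.induction_linear with
  | zero => simp
  | add f g hf hg =>
    rw [map_add, inner_add_left, hf, hg, Finsupp.sum_add_index' (by simp) (by intros; ring)]
  | single x a =>
    have : Finsupp.single x a = a • Finsupp.single x (1 : ℝ) := by simp
    rw [Finsupp.sum_single_index (by simp), hJ.H_val, this, map_smul, real_inner_smul_left]

/-- The values of H determine all pairings with C_c(X), which is dense. Thus Hg = 1_x has at most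
one solution in E, and E embeds into the functions on X. -/
lemma eq_of_H_val_eq {ξ η : E} (h : B.H q (val J ξ) = B.H q (val J η)) : ξ = η := by
  refine hJ.dense.eq_of_inner_right (𝕜 := ℝ) fun φ => ?_
  rw [hJ.inner_J_left, hJ.inner_J_left, h]

lemma val_injective : Function.Injective (val J) := fun _ _ h =>
  hJ.eq_of_H_val_eq (by rw [h])

lemma H_val_kernel (x : X) : B.H q (val J (kernel J x)) = ind x := by
  classical
  ext y
  rw [hJ.H_val, real_inner_comm, hJ.inner_kernel_J]
  simp [ind, Finsupp.single_apply, Set.indicator_apply, eq_comm]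

lemma kernel_ne_zero (x : X) : kernel J x ≠ 0 := fun h => by
  have := hJ.inner_kernel_J x (Finsupp.single x 1)
  simp [h] at this

/-- Boundedness of evaluation at o makes ‖·‖_{h,o} equivalent to √h, so the extended space does not
depend on o. -/
lemma approxExt_iff {o : X} {φ : ℕ → X →₀ ℝ} {f : X → ℝ} :
    B.ApproxExt q o φ f ↔ ∃ ξ, Tendsto (fun n => J (φ n)) atTop (𝓝 ξ) ∧ val J ξ = f := by
  have hval : ∀ ξ, Tendsto (fun n => J (φ n)) atTop (𝓝 ξ) →
      ∀ x, Tendsto (fun n => φ n x) atTop (𝓝 (val J ξ x)) := fun ξ hξ x => by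
    simpa [Function.comp_def, hJ.val_J] using ((continuous_val (J := J) x).tendsto ξ).comp hξ
  have hdist : ∀ m n, dist (J (φ m)) (J (φ n)) = √(B.h q (φ m - φ n) (φ m - φ n)) := fun m n => by
    rw [dist_eq_norm, ← map_sub, hJ.norm_eq]
  constructor
  · rintro ⟨h1, h2⟩
    have hc : CauchySeq fun n => J (φ n) := Metric.cauchySeq_iff.2 fun ε hε => by
      obtain ⟨N, hN⟩ := h1 ε hε
      refine ⟨N, fun m hm n hn => (hdist m n).trans_lt (lt_of_le_of_lt ?_ (hN m hm n hn))⟩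
      exact Real.sqrt_le_sqrt (le_add_of_nonneg_right (sq_nonneg _))
    obtain ⟨ξ, hξ⟩ := cauchySeq_tendsto_of_complete hc
    exact ⟨ξ, hξ, funext fun x => tendsto_nhds_unique (hval ξ hξ x) (h2 x)⟩
  · rintro ⟨ξ, hξ, rfl⟩
    refine ⟨fun ε hε => ?_, hval ξ hξ⟩
    -- The constant of this equivalence: h(φ) + φ(o)² ≤ (1 + ‖k_o‖²) h(φ).
    have hpos : 0 < √(1 + ‖kernel J o‖ ^ 2) := Real.sqrt_pos.2 (by positivity)
    obtain ⟨N, hN⟩ := Metric.cauchySeq_iff.1 hξ.cauchySeq (ε / √(1 + ‖kernel J o‖ ^ 2))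
      (by positivity)
    refine ⟨N, fun m hm n hn => ?_⟩
    have h1 := hN m hm n hn
    rw [lt_div_iff₀' hpos, dist_eq_norm, ← map_sub] at h1
    refine lt_of_le_of_lt ?_ h1
    refine Real.sqrt_le_iff.2 ⟨by positivity, ?_⟩
    rw [mul_pow, Real.sq_sqrt (by positivity), ← hJ.norm_sq_eq, ← hJ.inner_kernel_J o]
    have := abs_real_inner_le_norm (kernel J o) (J (φ m - φ n))
    rw [← sq_abs (inner ℝ _ _)]
    nlinarith [abs_nonneg (inner ℝ (kernel J o) (J (φ m - φ n)))]

lemma mem_Dext_iff {o : X} {f : X → ℝ} : f ∈ B.Dext q o ↔ ∃ ξ, val J ξ = f := by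
  constructor
  · rintro ⟨φ, hφ⟩
    obtain ⟨ξ, -, h⟩ := hJ.approxExt_iff.1 hφ
    exact ⟨ξ, h⟩
  · rintro ⟨ξ, rfl⟩
    obtain ⟨u, hu, hlim⟩ := mem_closure_iff_seq_limit.1 (hJ.dense ξ)
    choose φ hφ using hu
    exact ⟨φ, hJ.approxExt_iff.2 ⟨ξ, by simpa [hφ] using hlim, rfl⟩⟩

lemma quadExt_val (o : X) (ξ : E) : B.quadExt q o (val J ξ) = ‖ξ‖ ^ 2 := by
  have hf : ∃ φ, B.ApproxExt q o φ (val J ξ) := hJ.mem_Dext_iff.2 ⟨ξ, rfl⟩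
  rw [quadExt, dif_pos hf]
  obtain ⟨η, hη, hηξ⟩ := hJ.approxExt_iff.1 hf.choose_spec
  rw [hJ.val_injective hηξ] at hη
  refine Tendsto.limUnder_eq ?_
  simpa [hJ.norm_sq_eq] using hη.norm.pow 2

lemma formExt_val (o : X) (ξ η : E) : B.formExt q o (val J ξ) (val J η) = inner ℝ ξ η := by
  rw [formExt, ← map_add, ← map_sub, hJ.quadExt_val, hJ.quadExt_val,
    norm_add_sq_real, norm_sub_sq_real]
  ring

lemma normExt_val (o : X) (ξ : E) : B.normExt q o (val J ξ) = √(‖ξ‖ ^ 2 + val J ξ o ^ 2) := by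
  rw [normExt, hJ.quadExt_val]

end IsCompletion

end WGraph
end SchrodingerGraph

/-! ### Minimum principle, finite approximations, capacity and characterizations of the kernel. -/

namespace SchrodingerGraph

lemma ind_nonneg {X : Type*} (x y : X) : 0 ≤ ind x y :=
  Set.indicator_nonneg (fun _ _ => zero_le_one) y

@[simp] lemma ind_self {X : Type*} (x : X) : ind x x = 1 := by simp [ind]

lemma single_one_eq_ind {X : Type*} (x y : X) : Finsupp.single x (1 : ℝ) y = ind x y := by
  classical
  simp [ind, Finsupp.single_apply, Set.indicator_apply, eq_comm]

namespace WGraph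

variable {X : Type*} {B : WGraph X} {q : X → ℝ}

/-- Minimum principle on finite sets. -/
lemma PointBounded.nonneg_of_supersolution (hq : B.PointBounded q) {K : Finset X} {f : X → ℝ}
    (hf : f ∈ B.F) (hK : ∀ y ∈ K, 0 ≤ B.H q f y) (hKc : ∀ y ∉ K, 0 ≤ f y) (y : X) : 0 ≤ f y := by
  -- φ is the negative part of f, supported in K, and f + φ is the positive part. The aim is h(φ) ≤
  -- 0.
  let φ : X →₀ ℝ := Finsupp.onFinset K (fun x => max (-f x) 0) fun x hx => by
    by_contra hxK
    exact hx (max_eq_right (by linarith [hKc x hxK]))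
  have hφ : ∀ x, φ x = max (-f x) 0 := fun x => rfl
  have hp : f + φ ∈ B.F := add_mem_F hf (finsupp_mem_F φ)
  have hp0 : ∀ x, 0 ≤ (f + ⇑φ) x := fun x => by
    rw [Pi.add_apply, hφ]
    linarith [le_max_left (-f x) 0]
  have hzero : φ = 0 := by
    refine hq.eq_zero ?_
    rw [h_eq_sum]
    refine Finset.sum_nonpos fun x hx => ?_
    have hx0 : φ x ≠ 0 := Finsupp.mem_support_iff.1 hx
    have hxK : x ∈ K := Finsupp.support_onFinset_subset hx
    have hpos : 0 < φ x := lt_of_le_of_ne (le_max_right _ _) hx0.symm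
    -- Where φ > 0 the positive part vanishes, so its H-value there is minus a nonnegative sum,
    -- while Hf ≥ 0; hence Hφ ≤ 0 on the support of φ.
    have hpx : (f + ⇑φ) x = 0 := by
      rw [hφ] at hpos
      rw [Pi.add_apply, hφ, max_eq_left_of_lt ((lt_max_iff.1 hpos).resolve_right (lt_irrefl 0))]
      ring
    have hH := congrFun (H_add (q := q) hf (finsupp_mem_F φ)) x
    rw [H_eq hp, hpx, Pi.add_apply] at hH
    have hs : 0 ≤ ∑' y, B.b x y * (f + ⇑φ) y :=
      tsum_nonneg fun y => mul_nonneg (B.nonneg _ _) (hp0 y)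
    exact mul_nonpos_of_nonneg_of_nonpos hpos.le (by linarith [hK x hxK])
  have := hφ y
  rw [hzero, Finsupp.coe_zero, Pi.zero_apply] at this
  linarith [le_max_left (-f y) 0]

/-- Extension by zero of a function on a finite set. -/
noncomputable def extendK (K : Finset X) (v : K → ℝ) : X →₀ ℝ :=
  ∑ z : K, Finsupp.single z.1 (v z)

lemma extendK_apply_mem {K : Finset X} (v : K → ℝ) (y : K) : extendK K v y = v y := by
  classical
  simp [extendK, Finsupp.finsetSum_apply, Finsupp.single_apply]

lemma extendK_apply_notMem {K : Finset X} (v : K → ℝ) {y : X} (hy : y ∉ K) :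
    extendK K v y = 0 := by
  classical
  rw [extendK, Finsupp.finsetSum_apply]
  refine Finset.sum_eq_zero fun z _ => Finsupp.single_eq_of_ne ?_
  rintro rfl
  exact hy z.2

lemma h_eq_zero_of_H_eq_zero {K : Finset X} {φ ψ : X →₀ ℝ} (hφ : ∀ y ∉ K, φ y = 0)
    (hψ : ∀ y ∈ K, B.H q ψ y = 0) : B.h q φ ψ = 0 := by
  rw [h_eq_sum]
  refine Finset.sum_eq_zero fun x _ => ?_
  by_cases hx : x ∈ K
  · simp [hψ x hx]
  · simp [hφ x hx]

variable {E : Type*} [NormedAddCommGroup E] [InnerProductSpace ℝ E] [CompleteSpace E]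
  {J : (X →₀ ℝ) →ₗ[ℝ] E}

namespace IsCompletion

variable (hJ : B.IsCompletion q J)
include hJ

lemma HK_mulVec (K : Finset X) (v : K → ℝ) (y : K) :
    (B.HK q K).mulVec v y = B.H q (extendK K v) y := by
  have h1 : ∀ z : K, Finsupp.single z.1 (v z) = v z • Finsupp.single z.1 (1 : ℝ) := fun z => by simp
  rw [← hJ.val_J, hJ.H_val, extendK, map_sum, inner_sum]
  simp only [Matrix.mulVec, dotProduct, HK, Matrix.of_apply]
  refine Finset.sum_congr rfl fun z _ => ?_
  rw [h1 z, map_smul, inner_smul_right, hJ.inner_eq, mul_comm]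

lemma HK_mulVec_injective (K : Finset X) : Function.Injective (B.HK q K).mulVec := by
  intro v w hvw
  have h1 : (B.HK q K).mulVec (v - w) = 0 := by rw [Matrix.mulVec_sub, hvw, sub_self]
  have h2 : extendK K (v - w) = 0 := hJ.pointBounded.eq_zero <| le_of_eq <|
    h_eq_zero_of_H_eq_zero (K := K) (fun y hy => extendK_apply_notMem _ hy) fun y hy => by
      rw [← hJ.HK_mulVec K (v - w) ⟨y, hy⟩, h1, Pi.zero_apply]
  ext y
  have := extendK_apply_mem (v - w) y
  rw [h2] at this
  exact (sub_eq_zero.1 this.symm)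

lemma HK_mulVec_bijective (K : Finset X) : Function.Bijective (B.HK q K).mulVec :=
  ⟨hJ.HK_mulVec_injective K,
    LinearMap.injective_iff_surjective (f := (B.HK q K).mulVecLin).1 (hJ.HK_mulVec_injective K)⟩

lemma H_invHK {K : Finset X} (f : X → ℝ) {y : X} (hy : y ∈ K) :
    B.H q (B.invHK q K f) y = f y := by
  classical
  have hu : IsUnit (B.HK q K) := Matrix.mulVec_injective_iff_isUnit.1 (hJ.HK_mulVec_injective K)
  have h1 := hJ.HK_mulVec K ((B.HK q K)⁻¹.mulVec fun y : K => f y.1) ⟨y, hy⟩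
  rw [Matrix.mulVec_mulVec, Matrix.mul_nonsing_inv _ ((Matrix.isUnit_iff_isUnit_det _).1 hu),
    Matrix.one_mulVec] at h1
  convert h1.symm
  simp only [invHK, extendK]

lemma invHK_apply_notMem {K : Finset X} (f : X → ℝ) {y : X} (hy : y ∉ K) :
    B.invHK q K f y = 0 := extendK_apply_notMem _ hy

lemma invHK_nonneg (K : Finset X) {f : X → ℝ} (hf : ∀ y, 0 ≤ f y) (y : X) :
    0 ≤ B.invHK q K f y :=
  hJ.pointBounded.nonneg_of_supersolution (K := K) (finsupp_mem_F _)
    (fun y hy => by rw [hJ.H_invHK f hy]; exact hf y)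
    (fun y hy => (hJ.invHK_apply_notMem f hy).ge) y

/-- The solutions on finite sets lie below every nonnegative supersolution. -/
lemma invHK_le (K : Finset X) {f g : X → ℝ} (hg : g ∈ B.F) (hg0 : ∀ y, 0 ≤ g y)
    (hfg : ∀ y ∈ K, f y ≤ B.H q g y) (y : X) : B.invHK q K f y ≤ g y := by
  have hF := finsupp_mem_F (B := B) (B.invHK q K f)
  refine sub_nonneg.1 (hJ.pointBounded.nonneg_of_supersolution (K := K) (sub_mem_F hg hF)
    (fun y hy => ?_) (fun y hy => ?_) y)
  · rw [H_sub hg hF, Pi.sub_apply, hJ.H_invHK f hy]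
    linarith [hfg y hy]
  · rw [Pi.sub_apply, hJ.invHK_apply_notMem f hy, sub_zero]
    exact hg0 y

/-- The solution on L is a nonnegative supersolution for the problem on K. -/
lemma invHK_mono {K L : Finset X} (hKL : K ⊆ L) {f : X → ℝ} (hf : ∀ y, 0 ≤ f y) (y : X) :
    B.invHK q K f y ≤ B.invHK q L f y :=
  hJ.invHK_le K (finsupp_mem_F _) (hJ.invHK_nonneg L hf)
    (fun _ hy => (hJ.H_invHK f (hKL hy)).ge) y

/-- `J g` is the orthogonal projection of k_x onto J(C_c(K)): H(k_x - g) vanishes on K, so k_x - g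
is orthogonal to C_c(K). It is therefore at least as close to k_x as any φ supported in K, and such
φ are dense as K grows. -/
lemma tendsto_J_invHK (x : X) :
    Tendsto (fun K : Finset X => J (B.invHK q K (ind x))) atTop (𝓝 (kernel J x)) := by
  classical
  refine Metric.tendsto_nhds.2 fun ε hε => ?_
  obtain ⟨φ, hφ⟩ := Metric.denseRange_iff.1 hJ.dense (kernel J x) ε hε
  filter_upwards [eventually_ge_atTop (insert x φ.support)] with K hK
  have hφK : ∀ y ∉ K, φ y = 0 := fun y hy => Finsupp.notMem_support_iff.1 fun h =>
    hy (hK (Finset.mem_insert_of_mem h))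
  set g := B.invHK q K (ind x) with hg
  have horth : inner ℝ (kernel J x - J g) (J (g - φ)) = 0 := by
    rw [real_inner_comm, hJ.inner_J_left]
    refine Finset.sum_eq_zero fun y _ => ?_
    by_cases hy : y ∈ K
    · beta_reduce
      rw [map_sub, H_sub (hJ.val_mem_F _) (hJ.val_mem_F _), hJ.H_val_kernel, hJ.val_J,
        Pi.sub_apply, hJ.H_invHK _ hy, sub_self, mul_zero]
    · simp [hφK y hy, hg, hJ.invHK_apply_notMem _ hy]
  have hle : ‖kernel J x - J g‖ ≤ ‖kernel J x - J φ‖ := by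
    have h1 : kernel J x - J φ = (kernel J x - J g) + J (g - φ) := by rw [map_sub]; abel
    rw [h1]
    refine (sq_le_sq₀ (norm_nonneg _) (norm_nonneg _)).1 ?_
    rw [norm_add_sq_real, horth]
    nlinarith [sq_nonneg ‖J (g - φ)‖]
  rw [dist_comm, dist_eq_norm]
  rw [dist_eq_norm] at hφ
  exact hle.trans_lt hφ

lemma tendsto_invHK (x y : X) :
    Tendsto (fun K : Finset X => B.invHK q K (ind x) y) atTop (𝓝 (val J (kernel J x) y)) := by
  have := ((continuous_val (J := J) y).tendsto _).comp (hJ.tendsto_J_invHK x)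
  simpa [Function.comp_def, hJ.val_J] using this

lemma val_kernel_nonneg (x y : X) : 0 ≤ val J (kernel J x) y :=
  ge_of_tendsto' (hJ.tendsto_invHK x y) fun K => hJ.invHK_nonneg K (ind_nonneg x) y

/-- The Green kernel is the smallest nonnegative supersolution. -/
lemma val_kernel_le {x : X} {g : X → ℝ} (hg : g ∈ B.F) (hg0 : ∀ y, 0 ≤ g y)
    (hx : ∀ y, ind x y ≤ B.H q g y) (y : X) : val J (kernel J x) y ≤ g y :=
  le_of_tendsto' (hJ.tendsto_invHK x y) fun K => hJ.invHK_le K hg hg0 (fun y _ => hx y) y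

lemma val_kernel_self (x : X) : val J (kernel J x) x = ‖kernel J x‖ ^ 2 :=
  real_inner_self_eq_norm_sq _

/-- If φ(x) = ⟨k_x, Jφ⟩ = 1, Cauchy–Schwarz gives h(φ) ≥ 1/‖k_x‖², with equality in E at k_x/‖k_x‖².
Since that vector need not come from C_c(X), it is approximated. -/
lemma cap_eq (x : X) : B.cap q x = 1 / ‖kernel J x‖ ^ 2 := by
  have hN : 0 < ‖kernel J x‖ ^ 2 := by
    have := norm_pos_iff.2 (hJ.kernel_ne_zero x)
    positivity
  refine csInf_eq_of_forall_ge_of_forall_gt_exists_lt ⟨_, Finsupp.single x 1, by simp, rfl⟩ ?_ ?_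
  · rintro r ⟨φ, hφ, rfl⟩
    have h1 := abs_real_inner_le_norm (kernel J x) (J φ)
    rw [hJ.inner_kernel_J, hφ, abs_one] at h1
    rw [← hJ.norm_sq_eq, div_le_iff₀' hN, ← mul_pow]
    exact one_le_pow₀ h1
  · intro w hw
    obtain ⟨u, hu, hlim⟩ := mem_closure_iff_seq_limit.1
      (hJ.dense ((1 / ‖kernel J x‖ ^ 2) • kernel J x))
    choose φ hφ using hu
    have hval : Tendsto (fun n => φ n x) atTop (𝓝 1) := by
      have h1 := ((continuous_val (J := J) x).tendsto _).comp hlim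
      rw [map_smul, Pi.smul_apply, hJ.val_kernel_self, smul_eq_mul, one_div_mul_cancel hN.ne'] at h1
      simpa [Function.comp_def, ← hφ, hJ.val_J] using h1
    have hnorm : Tendsto (fun n => ‖J (φ n)‖ ^ 2 / φ n x ^ 2) atTop
        (𝓝 (1 / ‖kernel J x‖ ^ 2)) := by
      have h1 := (hlim.norm.pow 2).div (hval.pow 2) (by norm_num)
      have h2 : ‖(1 / ‖kernel J x‖ ^ 2) • kernel J x‖ ^ 2 / 1 ^ 2 = 1 / ‖kernel J x‖ ^ 2 := by
        rw [norm_smul, Real.norm_of_nonneg (by positivity)]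
        field_simp
      rw [h2] at h1
      simpa [hφ, Pi.div_def] using h1
    obtain ⟨n, hn1, hn2⟩ := ((hnorm.eventually_lt_const hw).and
      (hval.eventually_ne one_ne_zero)).exists
    -- The approximants have value near 1 at x; rescaling makes it exactly 1.
    refine ⟨_, ⟨(φ n x)⁻¹ • φ n, by simp [hn2], rfl⟩, ?_⟩
    rw [← hJ.norm_sq_eq, map_smul, norm_smul, mul_pow, norm_inv, inv_pow, Real.norm_eq_abs, sq_abs,
      inv_mul_eq_div]
    exact hn1

/-- Equality case of Cauchy–Schwarz: the squared distance from ξ to its projection on the line of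
k_x expands to 0. -/
lemma eq_smul_kernel {ξ : E} {o x : X} (hx : val J ξ x ≠ 0)
    (hcap : B.quadExt q o (fun y => val J ξ y / val J ξ x) = B.cap q x) :
    ξ = (val J ξ x / ‖kernel J x‖ ^ 2) • kernel J x := by
  have hN : 0 < ‖kernel J x‖ ^ 2 := by
    have := norm_pos_iff.2 (hJ.kernel_ne_zero x)
    positivity
  set c := val J ξ x with hc
  have h1 : (fun y => val J ξ y / c) = val J (c⁻¹ • ξ) := by
    rw [map_smul]; ext y; simp [div_eq_inv_mul]
  rw [h1, hJ.quadExt_val, hJ.cap_eq, norm_smul, mul_pow, norm_inv, inv_pow, Real.norm_eq_abs,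
    sq_abs] at hcap
  have h2 : ‖ξ‖ ^ 2 = c ^ 2 / ‖kernel J x‖ ^ 2 := by
    field_simp at hcap ⊢
    linarith
  rw [← sub_eq_zero, ← norm_eq_zero, ← sq_eq_zero_iff, norm_sub_sq_real, inner_smul_right,
    real_inner_comm, ← val_apply, ← hc, h2, norm_smul, mul_pow, Real.norm_eq_abs, sq_abs]
  field_simp
  ring

lemma smul_kernel_cap (o x : X) {c : ℝ} (hc : c ≠ 0) :
    (c • val J (kernel J x)) x ≠ 0 ∧
      B.quadExt q o (fun y => (c • val J (kernel J x)) y / (c • val J (kernel J x)) x) =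
        B.cap q x := by
  have hN := norm_ne_zero_iff.2 (hJ.kernel_ne_zero x)
  have h0 : (c • val J (kernel J x)) x = c * ‖kernel J x‖ ^ 2 := by
    rw [Pi.smul_apply, hJ.val_kernel_self, smul_eq_mul]
  refine ⟨by rw [h0]; positivity, ?_⟩
  have h1 : (fun y => (c • val J (kernel J x)) y / (c • val J (kernel J x)) x) =
      val J ((‖kernel J x‖ ^ 2)⁻¹ • kernel J x) := by
    rw [map_smul, h0]
    ext y
    simp only [Pi.smul_apply, smul_eq_mul]
    field_simp
  rw [h1, hJ.quadExt_val, hJ.cap_eq, norm_smul, norm_inv, Real.norm_of_nonneg (by positivity)]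
  field_simp

/-- Characterizations of the Green kernel in the extended space. -/
lemma tfae_kernel (o x : X) {g : X → ℝ} (hg : g ∈ B.Dext q o) :
    [ g = val J (kernel J x),
      g x ≠ 0 ∧ B.quadExt q o (fun y => g y / g x) = B.cap q x ∧ B.cap q x = 1 / g x,
      g ∈ B.F ∧ B.H q g = ind x,
      ∀ f ∈ B.Dext q o, B.formExt q o g f = f x ].TFAE := by
  obtain ⟨ξ, rfl⟩ := hJ.mem_Dext_iff.1 hg
  tfae_have 1 → 2 := fun h => by
    have := hJ.smul_kernel_cap o x one_ne_zero
    rw [one_smul, ← h] at this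
    refine ⟨this.1, this.2, ?_⟩
    rw [h, hJ.cap_eq, hJ.val_kernel_self]
  tfae_have 2 → 1 := by
    rintro ⟨h1, h2, h3⟩
    rw [hJ.eq_smul_kernel h1 h2]
    rw [hJ.cap_eq, one_div, one_div, inv_inj] at h3
    rw [← h3, div_self (pow_ne_zero 2 (norm_ne_zero_iff.2 (hJ.kernel_ne_zero x))), one_smul]
  tfae_have 1 → 3 := fun h => by
    rw [h]
    exact ⟨hJ.val_mem_F _, hJ.H_val_kernel x⟩
  tfae_have 3 → 1 := fun h => by
    rw [hJ.eq_of_H_val_eq (h.2.trans (hJ.H_val_kernel x).symm)]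
  tfae_have 1 → 4 := fun h f hf => by
    obtain ⟨η, rfl⟩ := hJ.mem_Dext_iff.1 hf
    rw [h, hJ.formExt_val, val_apply]
  tfae_have 4 → 1 := fun h => by
    congr 1
    refine ext_inner_right ℝ fun η => ?_
    rw [← hJ.formExt_val o, h _ (hJ.mem_Dext_iff.2 ⟨η, rfl⟩), val_apply]
  tfae_finish

lemma cap_attained_iff (o x : X) {g : X → ℝ} (hg : g ∈ B.Dext q o) :
    (g x ≠ 0 ∧ B.quadExt q o (fun y => g y / g x) = B.cap q x) ↔
      ∃ c : ℝ, c ≠ 0 ∧ g = c • val J (kernel J x) := by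
  obtain ⟨ξ, rfl⟩ := hJ.mem_Dext_iff.1 hg
  constructor
  · rintro ⟨h1, h2⟩
    refine ⟨_, div_ne_zero h1 (pow_ne_zero 2 (norm_ne_zero_iff.2 (hJ.kernel_ne_zero x))), ?_⟩
    rw [← map_smul, ← hJ.eq_smul_kernel h1 h2]
  · rintro ⟨c, hc, h⟩
    rw [h]
    exact hJ.smul_kernel_cap o x hc

lemma tendsto_normExt_invHK (o x : X) :
    Tendsto (fun K : Finset X => B.normExt q o (val J (kernel J x) - ⇑(B.invHK q K (ind x))))
      atTop (𝓝 0) := by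
  have h1 : ∀ K : Finset X, B.normExt q o (val J (kernel J x) - ⇑(B.invHK q K (ind x))) =
      √(‖kernel J x - J (B.invHK q K (ind x))‖ ^ 2 +
        val J (kernel J x - J (B.invHK q K (ind x))) o ^ 2) := fun K => by
    rw [← hJ.normExt_val, map_sub, hJ.val_J]
  have h2 : Tendsto (fun K : Finset X => kernel J x - J (B.invHK q K (ind x))) atTop (𝓝 0) := by
    simpa using (hJ.tendsto_J_invHK x).const_sub (kernel J x)
  have hc : Continuous fun ξ : E => √(‖ξ‖ ^ 2 + val J ξ o ^ 2) := by
    have := continuous_val (J := J) o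
    fun_prop
  simpa [h1, Function.comp_def] using (hc.tendsto 0).comp h2

/-- The Green kernel is the least nonnegative, nonzero supersolution. -/
lemma isLeast_kernel (x : X) :
    IsLeast {g : X → ℝ | g ∈ B.F ∧ 0 ≤ g ∧ g ≠ 0 ∧ ∀ y, ind x y ≤ B.H q g y}
      (val J (kernel J x)) := by
  refine ⟨⟨hJ.val_mem_F _, hJ.val_kernel_nonneg x, fun h => ?_, fun y => ?_⟩,
    fun g hg => hJ.val_kernel_le hg.1 hg.2.1 hg.2.2.2⟩
  · exact hJ.kernel_ne_zero x (hJ.val_injective (h.trans (map_zero _).symm))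
  · rw [hJ.H_val_kernel]

end IsCompletion

end WGraph
end SchrodingerGraph

/-! ### The closure of the form in ℓ²(X) and its resolvents. -/

namespace SchrodingerGraph

variable {X : Type*}

/-- `toL2` as a linear map. -/
noncomputable def toL2L : (X →₀ ℝ) →ₗ[ℝ] EllTwo X where
  toFun := toL2
  map_add' _ _ := rfl
  map_smul' _ _ := rfl

@[simp] lemma toL2L_apply (φ : X →₀ ℝ) : toL2L φ = toL2 φ := rfl

@[simp] lemma toL2_apply (φ : X →₀ ℝ) (x : X) : toL2 φ x = φ x := rfl

lemma inner_toL2_left (φ : X →₀ ℝ) (f : EllTwo X) :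
    inner ℝ (toL2 φ) f = φ.sum fun x a => a * f x := by
  rw [lp.inner_eq_tsum, tsum_eq_sum (s := φ.support)]
  · exact Finset.sum_congr rfl fun x _ => by simp [mul_comm]
  · intro x hx
    simp [Finsupp.notMem_support_iff.1 hx]

lemma inner_toL2_single (x : X) (f : EllTwo X) :
    inner ℝ (toL2 (Finsupp.single x 1)) f = f x := by
  rw [inner_toL2_left, Finsupp.sum_single_index (by simp), one_mul]

lemma norm_sq_toL2 (φ : X →₀ ℝ) : ‖toL2 φ‖ ^ 2 = ∑ x ∈ φ.support, φ x * φ x := by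
  rw [← real_inner_self_eq_norm_sq, inner_toL2_left]
  rfl

lemma continuous_ellTwo_apply (x : X) : Continuous fun f : EllTwo X => f x := by
  simp only [← inner_toL2_single]
  fun_prop

namespace WGraph

variable {B : WGraph X} {q : X → ℝ} {α : ℝ}
variable {E : Type*} [NormedAddCommGroup E] [InnerProductSpace ℝ E] [CompleteSpace E]
  {J : (X →₀ ℝ) →ₗ[ℝ] E}

/-- The embedding of the form domain into `ℓ²(X)`. -/
noncomputable def embL2 (J : (X →₀ ℝ) →ₗ[ℝ] E) : E →L[ℝ] EllTwo X := toL2L.extendOfNorm J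

namespace IsCompletion

variable (hJ : B.IsCompletion (fun x => q x + α) J) (hq : B.FormNonneg q) (hα : 0 < α)

include hJ in
lemma norm_sq_J (φ : X →₀ ℝ) : ‖J φ‖ ^ 2 = B.h q φ φ + α * ‖toL2 φ‖ ^ 2 := by
  rw [hJ.norm_sq_eq, h_add_potential, norm_sq_toL2]

include hJ hq hα

lemma norm_toL2_le (φ : X →₀ ℝ) : ‖toL2L φ‖ ≤ (√α)⁻¹ * ‖J φ‖ := by
  rw [inv_mul_eq_div, le_div_iff₀' (Real.sqrt_pos.2 hα)]
  refine (sq_le_sq₀ (by positivity) (norm_nonneg _)).1 ?_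
  rw [mul_pow, Real.sq_sqrt hα.le, hJ.norm_sq_J, toL2L_apply]
  linarith [hq φ]

lemma embL2_J (φ : X →₀ ℝ) : embL2 J (J φ) = toL2 φ :=
  LinearMap.extendOfNorm_eq hJ.dense ⟨_, hJ.norm_toL2_le hq hα⟩ φ

lemma norm_embL2_le : ‖embL2 J‖ ≤ (√α)⁻¹ :=
  LinearMap.opNorm_extendOfNorm_le hJ.dense (by positivity) (hJ.norm_toL2_le hq hα)

lemma embL2_apply (ξ : E) (x : X) : embL2 J ξ x = val J ξ x := by
  refine hJ.dense.induction_on ξ (isClosed_eq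
    ((continuous_ellTwo_apply x).comp (embL2 J).continuous) (continuous_val x)) fun φ => ?_
  rw [hJ.embL2_J hq hα, hJ.val_J, toL2_apply]

/-- This is closability of h in ℓ²(X): a vector of the form completion is determined by its
function. -/
lemma embL2_injective : Function.Injective (embL2 J) := fun ξ η h =>
  hJ.val_injective (funext fun x => by
    rw [← hJ.embL2_apply hq hα, ← hJ.embL2_apply hq hα, h])

lemma approxL2_iff {φ : ℕ → X →₀ ℝ} {f : EllTwo X} :
    B.ApproxL2 q φ f ↔ ∃ ξ, Tendsto (fun n => J (φ n)) atTop (𝓝 ξ) ∧ embL2 J ξ = f := by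
  have hval : ∀ ξ, Tendsto (fun n => J (φ n)) atTop (𝓝 ξ) →
      Tendsto (fun n => toL2 (φ n)) atTop (𝓝 (embL2 J ξ)) := fun ξ hξ => by
    simpa [Function.comp_def, hJ.embL2_J hq hα] using ((embL2 J).continuous.tendsto ξ).comp hξ
  have hdist : ∀ m n, dist (J (φ m)) (J (φ n)) ^ 2 =
      B.h q (φ m - φ n) (φ m - φ n) + α * dist (toL2 (φ m)) (toL2 (φ n)) ^ 2 := fun m n => by
    rw [dist_eq_norm, ← map_sub, hJ.norm_sq_J, dist_eq_norm, ← toL2L_apply, map_sub]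
    rfl
  constructor
  · rintro ⟨h1, h2⟩
    have hc : CauchySeq fun n => J (φ n) := Metric.cauchySeq_iff.2 fun ε hε => by
      obtain ⟨N, hN⟩ := h1 (ε ^ 2 / 2) (by positivity)
      obtain ⟨M, hM⟩ := Metric.cauchySeq_iff.1 h2.cauchySeq (√(ε ^ 2 / 2 / α))
        (Real.sqrt_pos.2 (by positivity))
      refine ⟨max N M, fun m hm n hn => lt_of_pow_lt_pow_left₀ 2 hε.le ?_⟩
      have h3 := hN m (le_of_max_le_left hm) n (le_of_max_le_left hn)
      have h4 := hM m (le_of_max_le_right hm) n (le_of_max_le_right hn)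
      rw [Real.lt_sqrt dist_nonneg, lt_div_iff₀' hα] at h4
      rw [hdist]
      linarith
    obtain ⟨ξ, hξ⟩ := cauchySeq_tendsto_of_complete hc
    exact ⟨ξ, hξ, tendsto_nhds_unique (hval ξ hξ) h2⟩
  · rintro ⟨ξ, hξ, rfl⟩
    refine ⟨fun ε hε => ?_, hval ξ hξ⟩
    obtain ⟨N, hN⟩ := Metric.cauchySeq_iff.1 hξ.cauchySeq (√ε) (Real.sqrt_pos.2 hε)
    refine ⟨N, fun m hm n hn => ?_⟩
    have h1 := hN m hm n hn
    rw [Real.lt_sqrt dist_nonneg, hdist] at h1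
    have : 0 ≤ α * dist (toL2 (φ m)) (toL2 (φ n)) ^ 2 := by positivity
    linarith

lemma mem_domL2_iff {f : EllTwo X} : f ∈ B.domL2 q ↔ ∃ ξ, embL2 J ξ = f := by
  constructor
  · rintro ⟨φ, hφ⟩
    obtain ⟨ξ, -, h⟩ := (hJ.approxL2_iff hq hα).1 hφ
    exact ⟨ξ, h⟩
  · rintro ⟨ξ, rfl⟩
    obtain ⟨u, hu, hlim⟩ := mem_closure_iff_seq_limit.1 (hJ.dense ξ)
    choose φ hφ using hu
    exact ⟨φ, (hJ.approxL2_iff hq hα).2 ⟨ξ, by simpa [hφ] using hlim, rfl⟩⟩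

lemma quadL2_embL2 (ξ : E) : B.quadL2 q (embL2 J ξ) = ‖ξ‖ ^ 2 - α * ‖embL2 J ξ‖ ^ 2 := by
  have hf : ∃ φ, B.ApproxL2 q φ (embL2 J ξ) := (hJ.mem_domL2_iff hq hα).2 ⟨ξ, rfl⟩
  rw [quadL2, dif_pos hf]
  obtain ⟨η, hη, hηξ⟩ := (hJ.approxL2_iff hq hα).1 hf.choose_spec
  rw [hJ.embL2_injective hq hα hηξ] at hη
  refine Tendsto.limUnder_eq ?_
  have h1 := (hη.norm.pow 2).sub ((hf.choose_spec.2.norm.pow 2).const_mul α)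
  refine h1.congr fun n => ?_
  rw [hJ.norm_sq_J]
  ring

lemma formL2_embL2 (ξ η : E) : B.formL2 q (embL2 J ξ) (embL2 J η) =
    inner ℝ ξ η - α * inner ℝ (embL2 J ξ) (embL2 J η) := by
  rw [formL2, ← map_add, ← map_sub, hJ.quadL2_embL2 hq hα, hJ.quadL2_embL2 hq hα, map_add, map_sub]
  simp only [norm_add_sq_real, norm_sub_sq_real]
  ring

/-- With ι = `embL2 J` and u = ιξ, the equation (H⁽¹⁾+α)u = f reads ⟨ξ, η⟩ = ⟨f, ιη⟩ for all η in
the form domain, that is, ξ = ι*f. -/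
lemma opL2_iff {f u : EllTwo X} :
    B.OpL2 q u (f + (-α) • u) ↔ embL2 J ((embL2 J).adjoint f) = u := by
  constructor
  · rintro ⟨hu, h⟩
    obtain ⟨ξ, rfl⟩ := (hJ.mem_domL2_iff hq hα).1 hu
    congr 1
    refine ext_inner_right ℝ fun η => ?_
    have := h _ ((hJ.mem_domL2_iff hq hα).2 ⟨η, rfl⟩)
    rw [hJ.formL2_embL2 hq hα, inner_add_left, real_inner_smul_left] at this
    rw [ContinuousLinearMap.adjoint_inner_left]
    linarith
  · rintro rfl
    refine ⟨(hJ.mem_domL2_iff hq hα).2 ⟨_, rfl⟩, fun v hv => ?_⟩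
    obtain ⟨η, rfl⟩ := (hJ.mem_domL2_iff hq hα).1 hv
    rw [hJ.formL2_embL2 hq hα, inner_add_left, real_inner_smul_left,
      ContinuousLinearMap.adjoint_inner_left]
    ring

lemma isResolvent_embL2 : B.IsResolvent q (-α) (embL2 J ∘L (embL2 J).adjoint) := fun _ _ =>
  (hJ.opL2_iff hq hα).symm

lemma res_eq : B.res q (-α) = embL2 J ∘L (embL2 J).adjoint := by
  have hR : ∃ R, B.IsResolvent q (-α) R := ⟨_, hJ.isResolvent_embL2 hq hα⟩
  rw [res, dif_pos hR]
  ext1 f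
  exact (hR.choose_spec f _).2 ((hJ.isResolvent_embL2 hq hα f _).1 rfl)

/-- ι*1_x represents evaluation at x, so it is the kernel for q + α. -/
lemma res_single_apply (x y : X) :
    B.res q (-α) (toL2 (Finsupp.single x 1)) y = val J (kernel J x) y := by
  have : (embL2 J).adjoint (toL2 (Finsupp.single x 1)) = kernel J x :=
    ext_inner_right ℝ fun η => by
      rw [ContinuousLinearMap.adjoint_inner_left, inner_toL2_single, hJ.embL2_apply hq hα,
        val_apply]
  rw [hJ.res_eq hq hα, ContinuousLinearMap.comp_apply, this, hJ.embL2_apply hq hα]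

lemma eq_zero_of_res_eq_zero {f : EllTwo X} (hf : B.res q (-α) f = 0) : f = 0 := by
  rw [hJ.res_eq hq hα, ContinuousLinearMap.comp_apply] at hf
  have h1 := hJ.embL2_injective hq hα (hf.trans (map_zero _).symm)
  ext x
  rw [← inner_toL2_single, ← hJ.embL2_J hq hα, ← ContinuousLinearMap.adjoint_inner_right, h1,
    inner_zero_right]
  rfl

end IsCompletion

lemma PointBounded.exists_isCompletion.{u} {X : Type u} {B : WGraph X} {q : X → ℝ}
    (hq : B.PointBounded q) :
    ∃ (E : Type u) (_ : NormedAddCommGroup E) (_ : InnerProductSpace ℝ E) (_ : CompleteSpace E)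
      (J : (X →₀ ℝ) →ₗ[ℝ] E), B.IsCompletion q J :=
  let ⟨E, i1, i2, i3, J, h1, h2⟩ := hq.exists_completion
  ⟨E, i1, i2, i3, J, hq, h1, h2⟩

/-! ### Bounds, symmetry, positivity and the resolvent identity. -/

namespace PointBounded

variable (hq : B.PointBounded q)
include hq

lemma isResolvent_res (hα : 0 < α) : B.IsResolvent q (-α) (B.res q (-α)) := by
  obtain ⟨E, _, _, _, J, hJ⟩ := (hq.add_const hα.le).exists_isCompletion
  rw [hJ.res_eq hq.1 hα]
  exact hJ.isResolvent_embL2 hq.1 hα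

lemma norm_res_le (hα : 0 < α) : ‖B.res q (-α)‖ ≤ α⁻¹ := by
  obtain ⟨E, _, _, _, J, hJ⟩ := (hq.add_const hα.le).exists_isCompletion
  rw [hJ.res_eq hq.1 hα]
  refine (ContinuousLinearMap.opNorm_comp_le _ _).trans ?_
  rw [LinearIsometryEquiv.norm_map, ← Real.mul_self_sqrt hα.le, mul_inv]
  have := hJ.norm_embL2_le hq.1 hα
  exact mul_le_mul this this (norm_nonneg _) (by positivity)

lemma inner_res_left (hα : 0 < α) (f g : EllTwo X) :
    inner ℝ (B.res q (-α) f) g = inner ℝ f (B.res q (-α) g) := by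
  obtain ⟨E, _, _, _, J, hJ⟩ := (hq.add_const hα.le).exists_isCompletion
  rw [hJ.res_eq hq.1 hα, ContinuousLinearMap.comp_apply, ContinuousLinearMap.comp_apply,
    ← ContinuousLinearMap.adjoint_inner_right, ContinuousLinearMap.adjoint_inner_left]

lemma eq_zero_of_res_eq_zero (hα : 0 < α) {f : EllTwo X} (hf : B.res q (-α) f = 0) : f = 0 := by
  obtain ⟨E, _, _, _, J, hJ⟩ := (hq.add_const hα.le).exists_isCompletion
  exact hJ.eq_zero_of_res_eq_zero hq.1 hα hf

lemma res_single_nonneg (hα : 0 < α) (x y : X) :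
    0 ≤ B.res q (-α) (toL2 (Finsupp.single x 1)) y := by
  obtain ⟨E, _, _, _, J, hJ⟩ := (hq.add_const hα.le).exists_isCompletion
  rw [hJ.res_single_apply hq.1 hα]
  exact hJ.val_kernel_nonneg x y

lemma res_single_mem_F (hα : 0 < α) (x : X) :
    ⇑(B.res q (-α) (toL2 (Finsupp.single x 1))) ∈ B.F := by
  obtain ⟨E, _, _, _, J, hJ⟩ := (hq.add_const hα.le).exists_isCompletion
  rw [funext (hJ.res_single_apply hq.1 hα x)]
  exact hJ.val_mem_F _

lemma H_res_single (hα : 0 < α) (x y : X) :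
    B.H q (B.res q (-α) (toL2 (Finsupp.single x 1))) y +
      α * B.res q (-α) (toL2 (Finsupp.single x 1)) y = ind x y := by
  obtain ⟨E, _, _, _, J, hJ⟩ := (hq.add_const hα.le).exists_isCompletion
  rw [← H_add_potential, funext (hJ.res_single_apply hq.1 hα x), hJ.H_val_kernel]

lemma res_single_le (hα : 0 < α) {x : X} {g : X → ℝ} (hg : g ∈ B.F) (hg0 : ∀ y, 0 ≤ g y)
    (hx : ∀ y, ind x y ≤ B.H q g y + α * g y) (y : X) :
    B.res q (-α) (toL2 (Finsupp.single x 1)) y ≤ g y := by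
  obtain ⟨E, _, _, _, J, hJ⟩ := (hq.add_const hα.le).exists_isCompletion
  rw [hJ.res_single_apply hq.1 hα]
  exact hJ.val_kernel_le hg hg0 (fun y => by rw [H_add_potential]; exact hx y) y

/-- The nonnegative resolvent entry at -α is a supersolution for the larger shift β, so minimality
applies. -/
lemma res_single_anti {β : ℝ} (hα : 0 < α) (hαβ : α ≤ β) (x y : X) :
    B.res q (-β) (toL2 (Finsupp.single x 1)) y ≤ B.res q (-α) (toL2 (Finsupp.single x 1)) y := by
  refine hq.res_single_le (hα.trans_le hαβ) (hq.res_single_mem_F hα x)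
    (hq.res_single_nonneg hα x) (fun y => ?_) y
  have h1 := hq.H_res_single hα x y
  have h2 := mul_le_mul_of_nonneg_right hαβ (hq.res_single_nonneg hα x y)
  linarith

/-- The resolvent identity, applied to a vector. -/
lemma res_sub_res {β : ℝ} (hα : 0 < α) (hβ : 0 < β) (f : EllTwo X) :
    B.res q (-α) f - B.res q (-β) f = (β - α) • B.res q (-β) (B.res q (-α) f) := by
  have h1 := (hq.isResolvent_res hα f _).1 rfl
  have h2 : f + (-α) • B.res q (-α) f =
      (f + (β - α) • B.res q (-α) f) + (-β) • B.res q (-α) f := by module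
  rw [h2] at h1
  have h3 := (hq.isResolvent_res hβ _ _).2 h1
  rw [map_add, map_smul] at h3
  exact sub_eq_of_eq_add' h3.symm

/-- The resolvents preserve positivity. -/
lemma res_nonneg (hα : 0 < α) {f : EllTwo X} (hf : ∀ x, 0 ≤ f x) (x : X) :
    0 ≤ B.res q (-α) f x := by
  rw [← inner_toL2_single, ← hq.inner_res_left hα, lp.inner_eq_tsum]
  refine tsum_nonneg fun y => ?_
  simpa using mul_nonneg (hf y) (hq.res_single_nonneg hα x y)

end PointBounded

/-! ### Monotone convergence of the resolvents to the Green kernel. -/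

namespace IsCompletion

variable (hJ : B.IsCompletion q J)
include hJ

lemma res_single_le_kernel (hα : 0 < α) (x y : X) :
    B.res q (-α) (toL2 (Finsupp.single x 1)) y ≤ val J (kernel J x) y := by
  refine hJ.pointBounded.res_single_le hα (hJ.val_mem_F _) (hJ.val_kernel_nonneg x) (fun y => ?_) y
  rw [hJ.H_val_kernel]
  have := mul_nonneg hα.le (hJ.val_kernel_nonneg x y)
  linarith

lemma monotoneOn_res_single (x y : X) :
    MonotoneOn (fun l => B.res q l (toL2 (Finsupp.single x 1)) y) (Set.Iio 0) := by
  intro a ha b hb hab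
  have := hJ.pointBounded.res_single_anti (neg_pos.2 hb) (neg_le_neg hab) x y
  simpa using this

/-- The resolvents converge to the Green kernel. -/
lemma tendsto_res_single (x y : X) :
    Tendsto (fun l => B.res q l (toL2 (Finsupp.single x 1)) y) (𝓝[<] 0)
      (𝓝 (val J (kernel J x) y)) := by
  set r : ℝ → X → ℝ := fun l y => B.res q l (toL2 (Finsupp.single x 1)) y with hr
  have hneg : ∀ l : ℝ, r l = r (-(-l)) := fun l => by rw [neg_neg]
  have hle : ∀ l < 0, ∀ y, r l y ≤ val J (kernel J x) y := fun l hl y => by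
    rw [hneg]; exact hJ.res_single_le_kernel (neg_pos.2 hl) x y
  have h0 : ∀ l < 0, ∀ y, 0 ≤ r l y := fun l hl y => by
    rw [hneg]; exact hJ.pointBounded.res_single_nonneg (neg_pos.2 hl) x y
  have hF : ∀ l < 0, r l ∈ B.F := fun l hl => by
    rw [hneg]; exact hJ.pointBounded.res_single_mem_F (neg_pos.2 hl) x
  have hH : ∀ l < 0, ∀ y, B.H q (r l) y = ind x y + l * r l y := fun l hl y => by
    have := hJ.pointBounded.H_res_single (neg_pos.2 hl) x y
    rw [neg_neg] at this
    change B.H q (r l) y + -l * r l y = _ at this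
    linarith
  have hex : ∀ y, ∃ g, Tendsto (fun l => r l y) (𝓝[<] 0) (𝓝 g) := fun y =>
    ⟨_, MonotoneOn.tendsto_nhdsLT (hJ.monotoneOn_res_single x y)
      ⟨val J (kernel J x) y, by rintro _ ⟨l, hl, rfl⟩; exact hle l hl y⟩⟩
  choose g hg using hex
  have hlt : ∀ᶠ l : ℝ in 𝓝[<] 0, l < 0 := eventually_mem_nhdsWithin
  have hg0 : ∀ y, 0 ≤ g y := fun y =>
    ge_of_tendsto (hg y) (hlt.mono fun l hl => h0 l hl y)
  have hgle : ∀ y, g y ≤ val J (kernel J x) y := fun y =>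
    le_of_tendsto (hg y) (hlt.mono fun l hl => hle l hl y)
  have hgF : g ∈ B.F := mem_F_of_abs_le (hJ.val_mem_F (kernel J x)) fun y => by
    rw [abs_of_nonneg (hg0 y)]; exact hgle y
  have hHg : ∀ y, B.H q g y = ind x y := fun y => by
    have hsum : Tendsto (fun l => ∑' z, B.b y z * r l z) (𝓝[<] 0) (𝓝 (∑' z, B.b y z * g z)) := by
      -- All resolvent entries lie below the Green kernel, which is in F and serves as the majorant.
      refine tendsto_tsum_of_dominated_convergence (hJ.val_mem_F (kernel J x) y)
        (fun z => (hg z).const_mul _) (hlt.mono fun l hl z => ?_)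
      rw [norm_mul, Real.norm_of_nonneg (B.nonneg _ _), Real.norm_of_nonneg (h0 l hl z)]
      exact mul_le_mul_of_nonneg_left ((hle l hl z).trans (le_abs_self _)) (B.nonneg _ _)
    have h1 : Tendsto (fun l => B.H q (r l) y) (𝓝[<] 0) (𝓝 (B.H q g y)) := by
      rw [H_eq hgF]
      refine (((hg y).const_mul _).sub hsum).congr' (hlt.mono fun l hl => ?_)
      beta_reduce
      rw [H_eq (hF l hl)]
    have h2 : Tendsto (fun l => ind x y + l * r l y) (𝓝[<] 0) (𝓝 (ind x y + 0 * g y)) :=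
      ((tendsto_nhdsWithin_of_tendsto_nhds tendsto_id).mul (hg y)).const_add _
    have h3 := tendsto_nhds_unique h1 (h2.congr' (hlt.mono fun l hl => (hH l hl y).symm))
    simpa using h3
  -- The limit lies below the kernel, and is itself a nonnegative supersolution, so minimality of
  -- the kernel gives equality.
  have := (hgle y).antisymm (hJ.val_kernel_le hgF hg0 (fun y => (hHg y).ge) y)
  rw [← this]
  exact hg y

end IsCompletion

end WGraph
end SchrodingerGraph

/-! ### Hille–Yosida: strong convergence of the Yosida semigroups. -/

namespace SchrodingerGraph

section HilleYosida

variable {E : Type*} [NormedAddCommGroup E] [NormedSpace ℝ E] [CompleteSpace E]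

/-- Uniformly bounded operators that tend to zero on a dense range tend to zero strongly. -/
lemma tendsto_zero_of_denseRange {ι F : Type*} {l : Filter ι} {T : ι → E →L[ℝ] E} {C : ℝ}
    (hT : ∀ᶠ i in l, ‖T i‖ ≤ C) {e : F → E} (he : DenseRange e)
    (h : ∀ g, Tendsto (fun i => T i (e g)) l (𝓝 0)) (f : E) :
    Tendsto (fun i => T i f) l (𝓝 0) := by
  refine Metric.tendsto_nhds.2 fun ε hε => ?_
  obtain ⟨g, hg⟩ := Metric.denseRange_iff.1 he f (ε / (2 * (|C| + 1))) (by positivity)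
  filter_upwards [hT, Metric.tendsto_nhds.1 (h g) (ε / 2) (by positivity)] with i h1 h2
  rw [dist_zero_right] at h2 ⊢
  rw [dist_eq_norm, lt_div_iff₀ (by positivity)] at hg
  have h3 : ‖T i (f - e g)‖ ≤ (|C| + 1) * ‖f - e g‖ :=
    (T i).le_of_opNorm_le (h1.trans (by linarith [le_abs_self C])) _
  have h4 : T i f = T i (f - e g) + T i (e g) := by rw [map_sub, sub_add_cancel]
  rw [h4]
  linarith [norm_add_le (T i (f - e g)) (T i (e g))]

lemma norm_exp_le (T : E →L[ℝ] E) : ‖NormedSpace.exp T‖ ≤ Real.exp ‖T‖ := by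
  have h1 := NormedSpace.exp_series_hasSum_exp' (𝕂 := ℝ) T
  have h2 := NormedSpace.exp_series_hasSum_exp' (𝕂 := ℝ) ‖T‖
  rw [← Real.exp_eq_exp_ℝ] at h2
  refine h1.norm_le_of_bounded h2 fun n => ?_
  rw [norm_smul, Real.norm_of_nonneg (by positivity), smul_eq_mul]
  refine mul_le_mul_of_nonneg_left ?_ (by positivity)
  -- The zeroth power is separate: on a possibly trivial space the identity has norm at most 1, not
  -- necessarily 1.
  rcases n.eq_zero_or_pos with rfl | hn
  · rw [pow_zero, pow_zero]
    exact ContinuousLinearMap.norm_id_le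
  · exact norm_pow_le' T hn

lemma hasDerivAt_exp_neg_smul (A : E →L[ℝ] E) (t : ℝ) :
    HasDerivAt (fun s : ℝ => NormedSpace.exp ((-s) • A)) (-(NormedSpace.exp ((-t) • A) * A)) t := by
  have := hasDerivAt_exp_smul_const (𝕂 := ℝ) (-A) t
  simpa only [smul_neg, ← neg_smul, mul_neg] using this

/-- Duhamel's estimate for two commuting contraction semigroups. -/
lemma norm_exp_sub_exp_le {A A' : E →L[ℝ] E} (hc : Commute A A')
    (hA : ∀ t : ℝ, 0 ≤ t → ‖NormedSpace.exp ((-t) • A)‖ ≤ 1)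
    (hA' : ∀ t : ℝ, 0 ≤ t → ‖NormedSpace.exp ((-t) • A')‖ ≤ 1) {t : ℝ} (ht : 0 ≤ t) (f : E) :
    ‖NormedSpace.exp ((-t) • A) f - NormedSpace.exp ((-t) • A') f‖ ≤ t * ‖A f - A' f‖ := by
  -- U(s)V(s) = e^{-sA}e^{-(t-s)A'} interpolates between e^{-tA'} at s = 0 and e^{-tA} at s = t; its
  -- derivative on f is U(s)V(s)(A'f - Af).
  let U : ℝ → E →L[ℝ] E := fun s => NormedSpace.exp ((-s) • A)
  let V : ℝ → E →L[ℝ] E := fun s => NormedSpace.exp ((s - t) • A')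
  have hV : ∀ s, HasDerivAt V (V s * A') s := fun s =>
    (hasDerivAt_exp_smul_const (𝕂 := ℝ) A' (s - t)).comp_sub_const s t
  have hcom : ∀ s, Commute A (V s) := fun s => by
    let _ : NormedAlgebra ℚ (E →L[ℝ] E) := NormedAlgebra.restrictScalars ℚ ℝ _
    exact (hc.smul_right (s - t)).exp_right
  have hd : ∀ s, HasDerivAt (fun s => (U s * V s) f) ((U s * V s) (A' f - A f)) s := fun s => by
    have h1 := ((hasDerivAt_exp_neg_smul A s).mul (hV s)).clm_apply (hasDerivAt_const s f)
    refine h1.congr_deriv ?_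
    have h2 : -(NormedSpace.exp ((-s) • A) * A) * V s = -(U s * V s * A) := by
      rw [neg_mul, mul_assoc, (hcom s).eq, ← mul_assoc]
    rw [h2]
    simp [U, sub_eq_add_neg, add_comm]
  have hVn : ∀ s, s ≤ t → ‖V s‖ ≤ 1 := fun s hs => by
    have := hA' (t - s) (sub_nonneg.2 hs)
    rwa [neg_sub] at this
  have hb : ∀ s ∈ Set.Ico 0 t, ‖(U s * V s) (A' f - A f)‖ ≤ ‖A f - A' f‖ := fun s hs => by
    rw [norm_sub_rev (A f)]
    have h1 : ‖U s * V s‖ ≤ 1 := (norm_mul_le _ _).trans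
      (mul_le_one₀ (hA s hs.1) (norm_nonneg _) (hVn s hs.2.le))
    simpa using (U s * V s).le_of_opNorm_le h1 (A' f - A f)
  have := norm_image_sub_le_of_norm_deriv_le_segment' (fun s _ => (hd s).hasDerivWithinAt) hb t
    (Set.right_mem_Icc.2 ht)
  simpa [U, V, mul_comm] using this

/-- A family of resolvents `R α = (A + α)⁻¹`, `α > 0`, of a densely defined operator `A` such that
`-A` generates a contraction semigroup. -/
structure IsResolventFamily (R : ℝ → E →L[ℝ] E) : Prop where
  norm_le : ∀ {α}, 0 < α → ‖R α‖ ≤ α⁻¹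
  sub_eq : ∀ {α β}, 0 < α → 0 < β → ∀ f, R α f - R β f = (β - α) • R β (R α f)
  dense : DenseRange (R 1)

/-- The Yosida approximation `n A (A + n)⁻¹`. -/
noncomputable def yosidaApprox (R : ℝ → E →L[ℝ] E) (n : ℕ) : E →L[ℝ] E :=
  (n : ℝ) • ContinuousLinearMap.id ℝ E - (n : ℝ) ^ 2 • R n

/-- The scalar part n of the Yosida approximation commutes with everything and splits off. What is
left is an exponential of a positive multiple of the resolvent, the source of both contractivity and
positivity. -/
lemma exp_yosidaApprox (R : ℝ → E →L[ℝ] E) (n : ℕ) (t : ℝ) :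
    NormedSpace.exp ((-t) • yosidaApprox R n) =
      Real.exp (-(t * n)) • NormedSpace.exp ((t * n ^ 2) • R n) := by
  let _ : NormedAlgebra ℚ (E →L[ℝ] E) := NormedAlgebra.restrictScalars ℚ ℝ _
  have h1 : (-t) • yosidaApprox R n =
      algebraMap ℝ (E →L[ℝ] E) (-(t * n)) + (t * n ^ 2) • R n := by
    rw [yosidaApprox, Algebra.algebraMap_eq_smul_one, ContinuousLinearMap.one_def]
    module
  rw [h1, NormedSpace.exp_add_of_commute (Algebra.commutes _ _), ← NormedSpace.algebraMap_exp_comm,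
    ← Real.exp_eq_exp_ℝ, Algebra.algebraMap_eq_smul_one, smul_mul_assoc, one_mul]

namespace IsResolventFamily

variable {R : ℝ → E →L[ℝ] E} (hR : IsResolventFamily R)
include hR

/-- The resolvent identity and its version with α and β exchanged have opposite left sides. -/
lemma commute {α β : ℝ} (hα : 0 < α) (hβ : 0 < β) : Commute (R α) (R β) := by
  rcases eq_or_ne α β with rfl | hne
  · exact Commute.refl _
  ext f
  have h1 := hR.sub_eq hα hβ f
  have h2 := hR.sub_eq hβ hα f
  have h3 : (β - α) • (R α (R β f) - R β (R α f)) = 0 := by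
    rw [smul_sub, ← h1, ← neg_sub α β, neg_smul, ← h2]
    abel
  exact sub_eq_zero.1 ((smul_eq_zero.1 h3).resolve_left (sub_ne_zero.2 hne.symm))

lemma norm_smul_le {n : ℕ} (hn : 0 < n) : ‖(n : ℝ) • R n‖ ≤ 1 := by
  have hn' : (0 : ℝ) < n := Nat.cast_pos.2 hn
  rw [norm_smul, Real.norm_of_nonneg hn'.le, ← mul_inv_cancel₀ hn'.ne']
  exact mul_le_mul_of_nonneg_left (hR.norm_le hn') hn'.le

lemma commute_yosidaApprox {m n : ℕ} (hm : 0 < m) (hn : 0 < n) :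
    Commute (yosidaApprox R m) (yosidaApprox R n) := by
  have h := hR.commute (Nat.cast_pos.2 hm) (Nat.cast_pos.2 hn)
  have h1 : ∀ T : E →L[ℝ] E, Commute (ContinuousLinearMap.id ℝ E) T := Commute.one_left
  refine Commute.sub_left (((h1 _).smul_left _)) (Commute.smul_left ?_ _)
  exact Commute.sub_right ((h1 _).symm.smul_right _) (h.smul_right _)

lemma norm_exp_yosidaApprox_le {n : ℕ} (hn : 0 < n) {t : ℝ} (ht : 0 ≤ t) :
    ‖NormedSpace.exp ((-t) • yosidaApprox R n)‖ ≤ 1 := by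
  have hn' : (0 : ℝ) < n := Nat.cast_pos.2 hn
  rw [exp_yosidaApprox, norm_smul, Real.norm_of_nonneg (Real.exp_pos _).le]
  have h1 : ‖(t * n ^ 2) • R n‖ ≤ t * n := by
    have h2 : (t * (n : ℝ) ^ 2) • R n = (t * n) • ((n : ℝ) • R n) := by rw [smul_smul]; ring_nf
    rw [h2, norm_smul, Real.norm_of_nonneg (by positivity)]
    exact mul_le_of_le_one_right (by positivity) (hR.norm_smul_le hn)
  calc _ ≤ Real.exp (-(t * n)) * Real.exp (t * n) := by
        gcongr
        exact (norm_exp_le _).trans (Real.exp_le_exp.2 h1)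
    _ = 1 := by rw [← Real.exp_add, neg_add_cancel, Real.exp_zero]

/-- On the range of R₁ the error nR_nR₁g - R₁g equals R_n(R₁g - g), of size O(1/n); the uniform
bound ‖nR_n‖ ≤ 1 extends this to all f. -/
lemma tendsto_smul_apply (f : E) : Tendsto (fun n : ℕ => (n : ℝ) • R n f) atTop (𝓝 f) := by
  have key := tendsto_zero_of_denseRange (l := atTop) (C := 2)
    (T := fun n : ℕ => (n : ℝ) • R n - ContinuousLinearMap.id ℝ E) ?_ hR.dense (fun g => ?_) f
  · simpa using key.add_const f
  · filter_upwards [eventually_gt_atTop 0] with n hn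
    refine (norm_sub_le _ _).trans ?_
    linarith [hR.norm_smul_le hn, ContinuousLinearMap.norm_id_le (𝕜 := ℝ) (E := E)]
  · refine squeeze_zero_norm' (a := fun n : ℕ => (n : ℝ)⁻¹ * ‖R 1 g - g‖) ?_ ?_
    · filter_upwards [eventually_gt_atTop 0] with n hn
      have hn' : (0 : ℝ) < n := Nat.cast_pos.2 hn
      have h1 := hR.sub_eq one_pos hn' g
      have h2 : ((n : ℝ) • R n - ContinuousLinearMap.id ℝ E) (R 1 g) = R n (R 1 g - g) := by
        simp only [sub_apply, smul_apply, ContinuousLinearMap.id_apply, map_sub]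
        rw [sub_smul, one_smul] at h1
        rw [sub_eq_iff_eq_add] at h1 ⊢
        rw [← sub_eq_iff_eq_add'.2 (sub_eq_iff_eq_add.1 (sub_eq_of_eq_add h1))]
        abel
      rw [h2]
      exact (R n).le_of_opNorm_le (hR.norm_le hn') _
    · simpa using tendsto_inv_atTop_nhds_zero_nat.mul_const ‖R 1 g - g‖

/-- By the resolvent identity A_nR₁g = nR_n(g - R₁g). The limit is AR₁g, so the A_n converge on the
dense range of R₁, as Duhamel's estimate requires. -/
lemma tendsto_yosidaApprox (g : E) :
    Tendsto (fun n : ℕ => yosidaApprox R n (R 1 g)) atTop (𝓝 (g - R 1 g)) := by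
  refine (hR.tendsto_smul_apply (g - R 1 g)).congr' ?_
  filter_upwards [eventually_gt_atTop 0] with n hn
  have hn' : (0 : ℝ) < n := Nat.cast_pos.2 hn
  have h1 := hR.sub_eq one_pos hn' g
  have h2 : R 1 g = R n g + ((n : ℝ) - 1) • R n (R 1 g) := sub_eq_iff_eq_add'.1 h1
  simp only [yosidaApprox, sub_apply, smul_apply, ContinuousLinearMap.id_apply, map_sub]
  nth_rw 2 [h2]
  module

/-- The semigroups of the Yosida approximations converge strongly. -/
lemma exists_tendsto_exp {t : ℝ} (ht : 0 ≤ t) (f : E) :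
    ∃ u, Tendsto (fun n : ℕ => NormedSpace.exp ((-t) • yosidaApprox R n) f) atTop (𝓝 u) := by
  refine cauchySeq_tendsto_of_complete (cauchySeq_iff_tendsto_dist_atTop_0.2 ?_)
  have hpos : ∀ᶠ p : ℕ × ℕ in atTop, 0 < p.1 ∧ 0 < p.2 := by
    rw [← prod_atTop_atTop_eq]
    exact (eventually_gt_atTop 0).prod_mk (eventually_gt_atTop 0)
  have key := tendsto_zero_of_denseRange (l := atTop) (C := 2)
    (T := fun p : ℕ × ℕ => NormedSpace.exp ((-t) • yosidaApprox R p.1) -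
      NormedSpace.exp ((-t) • yosidaApprox R p.2)) ?_ hR.dense (fun g => ?_) f
  · simpa [dist_eq_norm] using key.norm
  · filter_upwards [hpos] with p hp
    refine (norm_sub_le _ _).trans ?_
    linarith [hR.norm_exp_yosidaApprox_le hp.1 ht, hR.norm_exp_yosidaApprox_le hp.2 ht]
  · refine squeeze_zero_norm' (a := fun p : ℕ × ℕ => t *
      dist (yosidaApprox R p.1 (R 1 g)) (yosidaApprox R p.2 (R 1 g))) ?_ ?_
    · filter_upwards [hpos] with p hp
      rw [dist_eq_norm]
      exact norm_exp_sub_exp_le (hR.commute_yosidaApprox hp.1 hp.2)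
        (fun _ => hR.norm_exp_yosidaApprox_le hp.1) (fun _ => hR.norm_exp_yosidaApprox_le hp.2) ht _
    · simpa using (cauchySeq_iff_tendsto_dist_atTop_0.1
        (hR.tendsto_yosidaApprox g).cauchySeq).const_mul t

end IsResolventFamily

end HilleYosida

end SchrodingerGraph

/-! ### Laplace transforms: from the semigroup to the resolvent, and the limit α → 0. -/

namespace SchrodingerGraph

section Laplace

variable {E : Type*} [NormedAddCommGroup E] [NormedSpace ℝ E] [CompleteSpace E]

lemma continuous_exp_neg_smul_apply (A : E →L[ℝ] E) (f : E) :
    Continuous fun t : ℝ => NormedSpace.exp ((-t) • A) f :=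
  continuous_iff_continuousAt.2 fun t =>
    ((hasDerivAt_exp_neg_smul A t).continuousAt.clm_apply continuousAt_const)

/-- The Laplace transform of a contraction semigroup with bounded generator. -/
lemma integral_exp_mul_semigroup {A S : E →L[ℝ] E} {α : ℝ} (hα : 0 < α)
    (hA : ∀ t : ℝ, 0 ≤ t → ‖NormedSpace.exp ((-t) • A)‖ ≤ 1)
    (hS : ∀ f, α • S f + A (S f) = f) (ℓ : E →L[ℝ] ℝ) (f : E) :
    ∫ t in Set.Ioi (0 : ℝ), Real.exp (-α * t) * ℓ (NormedSpace.exp ((-t) • A) f) = ℓ (S f) := by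
  have hbound : ∀ g : E, ∀ t : ℝ, 0 ≤ t →
      ‖Real.exp (-α * t) * ℓ (NormedSpace.exp ((-t) • A) g)‖ ≤
        Real.exp (-α * t) * (‖ℓ‖ * ‖g‖) := fun g t ht => by
    rw [norm_mul, Real.norm_of_nonneg (Real.exp_pos _).le]
    gcongr
    refine (ℓ.le_opNorm _).trans ?_
    gcongr
    simpa using (NormedSpace.exp ((-t) • A)).le_of_opNorm_le (hA t ht) g
  -- An explicit primitive of the integrand, by αS + AS = 1; its value at 0 is -ℓ(Sf) and it
  -- vanishes at infinity.
  have hd : ∀ t : ℝ, HasDerivAt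
      (fun t => -(Real.exp (-α * t) * ℓ (NormedSpace.exp ((-t) • A) (S f))))
      (Real.exp (-α * t) * ℓ (NormedSpace.exp ((-t) • A) f)) t := fun t => by
    have h1 : HasDerivAt (fun t : ℝ => Real.exp (-α * t)) (Real.exp (-α * t) * (-α)) t := by
      simpa using ((hasDerivAt_id t).const_mul (-α)).exp
    have h2 := ℓ.hasFDerivAt.comp_hasDerivAt t
      ((hasDerivAt_exp_neg_smul A t).clm_apply (hasDerivAt_const t (S f)))
    refine (h1.mul h2).neg.congr_deriv ?_
    nth_rw 3 [← hS f]
    simp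
    ring
  have hint : IntegrableOn (fun t => Real.exp (-α * t) * ℓ (NormedSpace.exp ((-t) • A) f))
      (Set.Ioi 0) := by
    refine Integrable.mono' ((integrableOn_exp_mul_Ioi (neg_lt_zero.2 hα) 0).mul_const (‖ℓ‖ * ‖f‖))
      (Continuous.aestronglyMeasurable ?_) ?_
    · have := continuous_exp_neg_smul_apply A f
      fun_prop
    · filter_upwards [ae_restrict_mem measurableSet_Ioi] with t ht
      exact hbound f t (le_of_lt ht)
  have hlim : Tendsto (fun t => -(Real.exp (-α * t) * ℓ (NormedSpace.exp ((-t) • A) (S f))))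
      atTop (𝓝 0) := by
    refine squeeze_zero_norm' (a := fun t => Real.exp (-α * t) * (‖ℓ‖ * ‖S f‖)) ?_ ?_
    · filter_upwards [eventually_ge_atTop 0] with t ht
      rw [norm_neg]
      exact hbound _ t ht
    · have h1 : Tendsto (fun t : ℝ => -α * t) atTop atBot :=
        tendsto_id.const_mul_atTop_of_neg (neg_lt_zero.2 hα)
      simpa using (Real.tendsto_exp_atBot.comp h1).mul_const (‖ℓ‖ * ‖S f‖)
  rw [integral_Ioi_of_hasDerivAt_of_tendsto' (fun t _ => hd t) hint hlim]
  simp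

namespace IsResolventFamily

variable {R : ℝ → E →L[ℝ] E} (hR : IsResolventFamily R)
include hR

/-- The resolvent of the Yosida approximation in terms of the resolvent family. -/
lemma yosidaApprox_resolvent {α : ℝ} (hα : 0 < α) {n : ℕ} (hn : 0 < n) (f : E) :
    let S : E →L[ℝ] E := ((n : ℝ) + α)⁻¹ • ContinuousLinearMap.id ℝ E +
      ((n : ℝ) / (n + α)) ^ 2 • R (n * α / (n + α))
    α • S f + yosidaApprox R n (S f) = f := by
  -- S comes from partial fractions: A_n + α = (n+α)(A+β)(A+n)⁻¹ with β = nα/(n+α), so its inverse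
  -- is (n+α)⁻¹(1 + (n-β)(A+β)⁻¹), and n - β = n²/(n+α).
  intro S
  have hn' : (0 : ℝ) < n := Nat.cast_pos.2 hn
  have h1 := hR.sub_eq (α := n * α / (n + α)) (by positivity) hn' f
  have h2 : R (n * α / (n + α)) f =
      R n f + ((n : ℝ) - n * α / (n + α)) • R n (R (n * α / (n + α)) f) :=
    sub_eq_iff_eq_add'.1 h1
  set u := R (n * α / (n + α)) f
  have h3 : S f = ((n : ℝ) + α)⁻¹ • f + ((n : ℝ) / (n + α)) ^ 2 • u := rfl
  have h4 : α • S f + yosidaApprox R n (S f) = ((n : ℝ) + α) • S f - (n : ℝ) ^ 2 • R n (S f) := by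
    simp only [yosidaApprox, sub_apply, smul_apply, ContinuousLinearMap.id_apply]
    module
  rw [h4, h3, map_add, map_smul, map_smul]
  have hna : (n : ℝ) + α ≠ 0 := by positivity
  have h5 : R n f = u - ((n : ℝ) - n * α / (n + α)) • R n u := eq_sub_of_add_eq h2.symm
  rw [h5]
  match_scalars <;> field_simp <;> ring

lemma tendsto_apply {α : ℝ} (hα : 0 < α) {ι : Type*} {l : Filter ι} {β : ι → ℝ}
    (hβ : Tendsto β l (𝓝 α)) (f : E) : Tendsto (fun i => R (β i) f) l (𝓝 (R α f)) := by
  refine tendsto_sub_nhds_zero_iff.1 ?_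
  refine squeeze_zero_norm' (a := fun i => |α - β i| * (α⁻¹ * ((β i)⁻¹ * ‖f‖))) ?_ ?_
  · filter_upwards [hβ.eventually_const_lt hα] with i hi
    rw [hR.sub_eq hi hα, norm_smul, Real.norm_eq_abs]
    gcongr
    refine ((R α).le_of_opNorm_le (hR.norm_le hα) _).trans ?_
    gcongr
    exact (R (β i)).le_of_opNorm_le (hR.norm_le hi) _
  · have := (hβ.const_sub α).abs.mul (((hβ.inv₀ hα.ne').mul_const ‖f‖).const_mul α⁻¹)
    simpa using this

/-- The Laplace transform of the limit semigroup is the resolvent. -/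
lemma integral_exp_mul_eq {T : ℝ → E} {f : E} (hT : ∀ t : ℝ, 0 ≤ t →
      Tendsto (fun n : ℕ => NormedSpace.exp ((-t) • yosidaApprox R n) f) atTop (𝓝 (T t)))
    {α : ℝ} (hα : 0 < α) (ℓ : E →L[ℝ] ℝ) :
    IntegrableOn (fun t => Real.exp (-α * t) * ℓ (T t)) (Set.Ioi 0) ∧
      ∫ t in Set.Ioi (0 : ℝ), Real.exp (-α * t) * ℓ (T t) = ℓ (R α f) := by
  -- The index n + 1 avoids n = 0, where nothing is known about R₀.
  set G : ℕ → ℝ → ℝ := fun n t =>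
    Real.exp (-α * t) * ℓ (NormedSpace.exp ((-t) • yosidaApprox R (n + 1)) f) with hG
  have hlim : ∀ᵐ t ∂volume.restrict (Set.Ioi (0 : ℝ)),
      Tendsto (fun n => G n t) atTop (𝓝 (Real.exp (-α * t) * ℓ (T t))) := by
    filter_upwards [ae_restrict_mem measurableSet_Ioi] with t ht
    exact (((ℓ.continuous.tendsto _).comp (hT t (le_of_lt ht))).comp
      (tendsto_add_atTop_nat 1)).const_mul _
  have hmeas : ∀ n, AEStronglyMeasurable (G n) (volume.restrict (Set.Ioi 0)) := fun n => by
    have := continuous_exp_neg_smul_apply (yosidaApprox R (n + 1)) f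
    exact Continuous.aestronglyMeasurable (by fun_prop)
  have hbound : ∀ n, ∀ᵐ t ∂volume.restrict (Set.Ioi (0 : ℝ)),
      ‖G n t‖ ≤ Real.exp (-α * t) * (‖ℓ‖ * ‖f‖) := fun n => by
    filter_upwards [ae_restrict_mem measurableSet_Ioi] with t ht
    rw [norm_mul, Real.norm_of_nonneg (Real.exp_pos _).le]
    gcongr
    refine (ℓ.le_opNorm _).trans ?_
    gcongr
    simpa using (NormedSpace.exp ((-t) • yosidaApprox R (n + 1))).le_of_opNorm_le
      (hR.norm_exp_yosidaApprox_le n.succ_pos (le_of_lt ht)) f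
  have hint : IntegrableOn (fun t => Real.exp (-α * t) * (‖ℓ‖ * ‖f‖)) (Set.Ioi 0) :=
    (integrableOn_exp_mul_Ioi (neg_lt_zero.2 hα) 0).mul_const _
  refine ⟨hint.mono' (aestronglyMeasurable_of_tendsto_ae _ hmeas hlim) ?_, ?_⟩
  · filter_upwards [ae_all_iff.2 hbound, hlim] with t h1 h2
    exact le_of_tendsto' h2.norm h1
  refine tendsto_nhds_unique
    (tendsto_integral_of_dominated_convergence _ hmeas hint hbound hlim) ?_
  have hn : Tendsto (fun n : ℕ => ((n + 1 : ℕ) : ℝ)) atTop atTop :=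
    tendsto_natCast_atTop_atTop.comp (tendsto_add_atTop_nat 1)
  have h1 : Tendsto (fun n : ℕ => (((n + 1 : ℕ) : ℝ) + α)⁻¹) atTop (𝓝 0) :=
    (tendsto_atTop_add_const_right _ α hn).inv_tendsto_atTop
  have h2 : Tendsto (fun n : ℕ => ((n + 1 : ℕ) : ℝ) / ((n + 1 : ℕ) + α)) atTop (𝓝 1) := by
    have : Tendsto (fun n : ℕ => 1 - α * (((n + 1 : ℕ) : ℝ) + α)⁻¹) atTop (𝓝 (1 - α * 0)) :=
      (h1.const_mul α).const_sub 1
    rw [mul_zero, sub_zero] at this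
    refine this.congr fun n => ?_
    have : ((n + 1 : ℕ) : ℝ) + α ≠ 0 := by positivity
    field_simp
    ring
  have h3 : Tendsto (fun n : ℕ => ((n + 1 : ℕ) : ℝ) * α / ((n + 1 : ℕ) + α)) atTop (𝓝 α) := by
    have := h2.mul_const α
    rw [one_mul] at this
    exact this.congr fun n => by ring
  have h4 := (h1.smul_const f).add ((h2.pow 2).smul (hR.tendsto_apply hα h3 f))
  rw [zero_smul, one_pow, one_smul, zero_add] at h4
  refine ((ℓ.continuous.tendsto _).comp h4).congr fun n => ?_
  rw [integral_exp_mul_semigroup hα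
    (fun _ => hR.norm_exp_yosidaApprox_le n.succ_pos) (hR.yosidaApprox_resolvent hα n.succ_pos)]
  rfl

end IsResolventFamily

/-- If the Laplace transform of a nonnegative function stays bounded and converges at `0`, then
the function is integrable, and its integral is the limit. -/
lemma integral_eq_of_tendsto_laplace {p r : ℝ → ℝ} (hp : ∀ t, 0 < t → 0 ≤ p t)
    (hint : ∀ α, 0 < α → IntegrableOn (fun t => Real.exp (-α * t) * p t) (Set.Ioi 0))
    (hr : ∀ α, 0 < α → ∫ t in Set.Ioi (0 : ℝ), Real.exp (-α * t) * p t = r α) {L : ℝ}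
    (hle : ∀ α, 0 < α → r α ≤ L) (hL : Tendsto r (𝓝[>] 0) (𝓝 L)) :
    IntegrableOn p (Set.Ioi 0) ∧ ∫ t in Set.Ioi (0 : ℝ), p t = L := by
  have hpos : ∀ n : ℕ, (0 : ℝ) < 1 / ((n : ℝ) + 1) := fun n => Nat.one_div_pos_of_nat
  have h0 : Tendsto (fun n : ℕ => 1 / ((n : ℝ) + 1)) atTop (𝓝[>] 0) :=
    tendsto_nhdsWithin_iff.2 ⟨tendsto_one_div_add_atTop_nhds_zero_nat, .of_forall hpos⟩
  set G : ℕ → ℝ → ℝ := fun n t => Real.exp (-(1 / ((n : ℝ) + 1)) * t) * p t with hG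
  have hlim : ∀ t, Tendsto (fun n => G n t) atTop (𝓝 (p t)) := fun t => by
    have h1 : Tendsto (fun n : ℕ => Real.exp (-(1 / ((n : ℝ) + 1)) * t) * p t) atTop
        (𝓝 (Real.exp (-0 * t) * p t)) :=
      ((Real.continuous_exp.tendsto _).comp
        ((tendsto_one_div_add_atTop_nhds_zero_nat.neg).mul_const t)).mul_const _
    simp only [neg_zero, zero_mul, Real.exp_zero, one_mul] at h1
    exact h1
  have hGi : ∀ n, IntegrableOn (G n) (Set.Ioi 0) := fun n => hint _ (hpos n)
  have hG0 : ∀ n, 0 ≤ᵐ[volume.restrict (Set.Ioi (0 : ℝ))] G n := fun n => by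
    filter_upwards [ae_restrict_mem measurableSet_Ioi] with t ht
    exact mul_nonneg (Real.exp_pos _).le (hp t ht)
  have hpi : IntegrableOn p (Set.Ioi 0) := by
    -- Fatou: the integrals of the nonnegative `G n` are bounded by L.
    refine integrable_of_tendsto (.of_forall hlim) (fun n => (hGi n).aestronglyMeasurable) ?_
    refine ne_top_of_le_ne_top (ENNReal.ofReal_ne_top (r := L)) ?_
    refine liminf_le_of_frequently_le' (Frequently.of_forall fun n => ?_)
    have h1 : ∫⁻ t in Set.Ioi (0 : ℝ), ‖G n t‖ₑ = ENNReal.ofReal (r (1 / ((n : ℝ) + 1))) := by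
      rw [← hr _ (hpos n), ofReal_integral_eq_lintegral_ofReal (hGi n) (hG0 n)]
      refine lintegral_congr_ae ?_
      filter_upwards [hG0 n] with t ht
      exact Real.enorm_of_nonneg ht
    rw [h1]
    exact ENNReal.ofReal_le_ofReal (hle _ (hpos n))
  refine ⟨hpi, tendsto_nhds_unique ?_ (hL.comp h0)⟩
  -- With p now known to be integrable, p itself dominates e^{-αt}p.
  have := tendsto_integral_of_dominated_convergence (μ := volume.restrict (Set.Ioi (0 : ℝ)))
    (F := G) (f := p) p (fun n => (hGi n).aestronglyMeasurable) hpi (fun n => ?_)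
    (.of_forall hlim)
  · exact this.congr fun n => hr _ (hpos n)
  · filter_upwards [ae_restrict_mem measurableSet_Ioi, hG0 n] with t ht h1
    rw [Real.norm_of_nonneg h1]
    refine mul_le_of_le_one_left (hp t ht) (Real.exp_le_one_iff.2 ?_)
    have : (0 : ℝ) < t := ht
    have := mul_pos (hpos n) this
    linarith

end Laplace

end SchrodingerGraph

/-! ### Positivity of the heat semigroup and identification of the Green function. -/

namespace SchrodingerGraph
namespace WGraph

variable {X : Type*} {B : WGraph X} {q : X → ℝ}

namespace PointBounded

variable (hq : B.PointBounded q)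
include hq

lemma isResolventFamily : IsResolventFamily fun α => B.res q (-α) where
  norm_le := hq.norm_res_le
  sub_eq := hq.res_sub_res
  dense := by
    change Dense ((LinearMap.range (B.res q (-1)).toLinearMap : Submodule ℝ (EllTwo X)) : Set (EllTwo X))
    rw [Submodule.dense_iff_topologicalClosure_eq_top, Submodule.topologicalClosure_eq_top_iff,
      Submodule.eq_bot_iff]
    intro f hf
    -- By symmetry of the resolvent, the orthogonal complement of its range is its null space, which
    -- is trivial.
    refine hq.eq_zero_of_res_eq_zero one_pos (ext_inner_left ℝ fun g => ?_)
    rw [← hq.inner_res_left one_pos, inner_zero_right]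
    exact hf _ ⟨g, rfl⟩

lemma tendsto_heat {t : ℝ} (ht : 0 ≤ t) (f : EllTwo X) :
    Tendsto (fun n : ℕ => NormedSpace.exp ((-t) • B.yosida q n) f) atTop (𝓝 (B.heat q t f)) :=
  tendsto_nhds_limUnder (hq.isResolventFamily.exists_tendsto_exp ht f)

/-- The exponential is a positive scalar times a power series with nonnegative coefficients in the
positivity preserving resolvent. -/
lemma exp_yosida_nonneg {n : ℕ} (hn : 0 < n) {t : ℝ} (ht : 0 ≤ t) {f : EllTwo X}
    (hf : ∀ x, 0 ≤ f x) (x : X) : 0 ≤ NormedSpace.exp ((-t) • B.yosida q n) f x := by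
  have hn' : (0 : ℝ) < n := Nat.cast_pos.2 hn
  have hpow : ∀ k : ℕ, ∀ y, 0 ≤ ((B.res q (-n)) ^ k) f y := fun k => by
    induction k with
    | zero => exact hf
    | succ k ih =>
      rw [pow_succ']
      exact hq.res_nonneg hn' ih
  have hexp := exp_yosidaApprox (fun α => B.res q (-α)) n t
  change NormedSpace.exp ((-t) • B.yosida q n) = _ at hexp
  rw [hexp]
  refine mul_nonneg (Real.exp_pos _).le ?_
  have h1 := NormedSpace.exp_series_hasSum_exp' (𝕂 := ℝ) ((t * (n : ℝ) ^ 2) • B.res q (-n))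
  have h2 := h1.mapL ((innerSL ℝ (toL2 (Finsupp.single x 1))).comp
    (ContinuousLinearMap.apply ℝ (EllTwo X) f))
  simp only [ContinuousLinearMap.comp_apply, ContinuousLinearMap.apply_apply, innerSL_apply_apply,
    inner_toL2_single] at h2
  refine h2.nonneg fun k => ?_
  rw [smul_pow]
  exact mul_nonneg (by positivity) (mul_nonneg (by positivity) (hpow k x))

lemma heat_nonneg {t : ℝ} (ht : 0 ≤ t) {f : EllTwo X} (hf : ∀ x, 0 ≤ f x) (x : X) :
    0 ≤ B.heat q t f x := by
  refine ge_of_tendsto (((continuous_ellTwo_apply x).tendsto _).comp (hq.tendsto_heat ht f)) ?_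
  filter_upwards [eventually_gt_atTop 0] with n hn
  exact hq.exp_yosida_nonneg hn ht hf x

end PointBounded

/-- The Green function is the Green kernel of the completion. -/
lemma IsCompletion.integral_heat {E : Type*} [NormedAddCommGroup E] [InnerProductSpace ℝ E]
    [CompleteSpace E] {J : (X →₀ ℝ) →ₗ[ℝ] E} (hJ : B.IsCompletion q J) (x y : X) :
    IntegrableOn (fun t => B.heat q t (toL2 (Finsupp.single x 1)) y) (Set.Ioi 0) ∧
      B.green q x y = val J (kernel J x) y := by
  have hq := hJ.pointBounded
  -- Tested against 1_y, the Laplace transform of the heat semigroup applied to 1_x is the resolvent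
  -- entry, which stays below the kernel and converges to it as α → 0.
  have key := fun α (hα : 0 < α) => hq.isResolventFamily.integral_exp_mul_eq
    (fun t ht => hq.tendsto_heat ht (toL2 (Finsupp.single x 1))) hα
    (innerSL ℝ (toL2 (Finsupp.single y 1)))
  simp only [innerSL_apply_apply, inner_toL2_single] at key
  refine integral_eq_of_tendsto_laplace
    (r := fun α => B.res q (-α) (toL2 (Finsupp.single x 1)) y)
    (fun t ht => hq.heat_nonneg ht.le (fun z => ?_) y)
    (fun α hα => (key α hα).1) (fun α hα => (key α hα).2)
    (fun α hα => hJ.res_single_le_kernel hα x y) ?_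
  · rw [toL2_apply, single_one_eq_ind]
    exact ind_nonneg x z
  · refine (hJ.tendsto_res_single x y).comp (tendsto_nhdsWithin_iff.2 ⟨?_, ?_⟩)
    · exact (continuous_neg.tendsto' (0 : ℝ) 0 neg_zero).mono_left nhdsWithin_le_nhds
    · filter_upwards [self_mem_nhdsWithin] with α hα
      exact Set.mem_Iio.2 (neg_lt_zero.2 (Set.mem_Ioi.1 hα))

end WGraph

lemma IsExhaustion.tendsto_atTop {X : Type*} {K : ℕ → Finset X} (hK : IsExhaustion K) :
    Tendsto K atTop atTop :=
  tendsto_atTop_finset_of_monotone (monotone_nat_of_le_succ hK.1) hK.2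

end SchrodingerGraph

/-! ### The theorem, with the Green function replaced throughout by the kernel of the completion. -/

theorem mainTheorem4 {X : Type*} [Infinite X] (B : SchrodingerGraph.WGraph X) (q : X → ℝ)
    (hconn : B.Connected) (hnonneg : B.FormNonneg q) (hsub : B.Subcritical q) :
    -- the resolvent, the semigroup and the Green function exist
    ((∀ l < 0, B.IsResolvent q l (B.res q l)) ∧
      (∀ t ≥ 0, ∀ f, Tendsto (fun n : ℕ => NormedSpace.exp ((-t) • B.yosida q n) f) atTop
        (𝓝 (B.heat q t f))) ∧
      (∀ x y, IntegrableOn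
        (fun t => B.heat q t (SchrodingerGraph.toL2 (Finsupp.single x 1)) y) (Set.Ioi 0))) ∧
    -- (a)
    ((∀ x y,
        MonotoneOn (fun l => B.res q l (SchrodingerGraph.toL2 (Finsupp.single x 1)) y)
          (Set.Iio 0) ∧
        Tendsto (fun l => B.res q l (SchrodingerGraph.toL2 (Finsupp.single x 1)) y)
          (𝓝[<] 0) (𝓝 (B.green q x y)) ∧
        B.green q x y = B.green q y x) ∧
      ∀ x, (fun y => B.green q x y) ∈ B.F ∧ (fun y => B.green q y x) ∈ B.F ∧
        B.H q (fun y => B.green q x y) = SchrodingerGraph.ind x ∧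
        B.H q (fun y => B.green q y x) = SchrodingerGraph.ind x) ∧
    -- (b)
    ((∀ K : Finset X, Function.Bijective (B.HK q K).mulVec) ∧
      (∀ K : ℕ → Finset X, SchrodingerGraph.IsExhaustion K → ∀ x,
        (∀ y, Monotone (fun n => B.invHK q (K n) (SchrodingerGraph.ind x) y) ∧
          Tendsto (fun n => B.invHK q (K n) (SchrodingerGraph.ind x) y) atTop
            (𝓝 (B.green q x y))) ∧
        ∀ o, Tendsto (fun n => B.normExt q o
          (B.green q x - ⇑(B.invHK q (K n) (SchrodingerGraph.ind x)))) atTop (𝓝 0)) ∧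
      ∀ o x, B.green q x ∈ B.Dext q o ∧
        ∀ g ∈ B.Dext q o,
          [ g = B.green q x,
            g x ≠ 0 ∧ B.quadExt q o (fun y => g y / g x) = B.cap q x ∧ B.cap q x = 1 / g x,
            g ∈ B.F ∧ B.H q g = SchrodingerGraph.ind x,
            ∀ f ∈ B.Dext q o, B.formExt q o g f = f x ].TFAE ∧
          (g x ≠ 0 ∧ B.quadExt q o (fun y => g y / g x) = B.cap q x ↔
            ∃ c : ℝ, c ≠ 0 ∧ g = c • B.green q x)) ∧
    -- (c)
    (∀ x, IsLeast {g : X → ℝ | g ∈ B.F ∧ 0 ≤ g ∧ g ≠ 0 ∧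
      ∀ y, SchrodingerGraph.ind x y ≤ B.H q g y} (B.green q x)) := by
  have hq := SchrodingerGraph.WGraph.pointBounded_of_subcritical hconn hnonneg hsub
  obtain ⟨E, _, _, _, J, hJ⟩ := hq.exists_isCompletion
  have hgreen : ∀ x, B.green q x =
      SchrodingerGraph.WGraph.val J (SchrodingerGraph.WGraph.kernel J x) := fun x =>
    funext fun y => (hJ.integral_heat x y).2
  have hsymm : ∀ x y, B.green q x y = B.green q y x := fun x y => by
    rw [hgreen, hgreen, SchrodingerGraph.WGraph.val_kernel_comm]
  have hgreen' : ∀ x, (fun y => B.green q x y) =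
      SchrodingerGraph.WGraph.val J (SchrodingerGraph.WGraph.kernel J x) := hgreen
  have hgreen'' : ∀ x, (fun y => B.green q y x) =
      SchrodingerGraph.WGraph.val J (SchrodingerGraph.WGraph.kernel J x) := fun x => by
    rw [← hgreen]
    exact funext fun y => hsymm y x
  refine ⟨⟨fun l hl => ?_, fun t ht f => hq.tendsto_heat ht f,
    fun x y => (hJ.integral_heat x y).1⟩,
    ⟨fun x y => ⟨hJ.monotoneOn_res_single x y, ?_, hsymm x y⟩, fun x => ?_⟩,
    ⟨hJ.HK_mulVec_bijective, fun K hK x => ⟨fun y => ⟨?_, ?_⟩, fun o => ?_⟩, fun o x => ⟨?_,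
      fun g hg => ⟨?_, ?_⟩⟩⟩, fun x => ?_⟩
  · simpa using hq.isResolvent_res (neg_pos.2 hl)
  · rw [hgreen]
    exact hJ.tendsto_res_single x y
  · rw [hgreen', hgreen'']
    exact ⟨hJ.val_mem_F _, hJ.val_mem_F _, hJ.H_val_kernel x, hJ.H_val_kernel x⟩
  · exact fun m n hmn => hJ.invHK_mono (monotone_nat_of_le_succ hK.1 hmn)
      (SchrodingerGraph.ind_nonneg x) y
  · rw [hgreen]
    exact (hJ.tendsto_invHK x y).comp hK.tendsto_atTop
  · rw [hgreen]
    exact (hJ.tendsto_normExt_invHK o x).comp hK.tendsto_atTop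
  · rw [hgreen]
    exact hJ.mem_Dext_iff.2 ⟨_, rfl⟩
  · rw [hgreen]
    exact hJ.tfae_kernel o x hg
  · rw [hgreen]
    exact hJ.cap_attained_iff o x hg
  · rw [hgreen]
    exact hJ.isLeast_kernel x
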